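/- \textbf{Theorem.} A point configuration in $\mathbb Z_{\ge 0}$ is identified with its indicator function, so that the space $\mathrm{Conf}(\mathbb Z_{\ge 0})=\{0,1\}^{\mathbb Z_{\ge 0}}$ of configurations carries the product topology. For a kernel $K:\mathbb Z_{\ge 0}\times\mathbb Z_{\ge 0}\to\mathbb R$, the determinantal measure $\mathbf P_K$ is the unique probability measure (if it exists) on $\mathrm{Conf}(\mathbb Z_{\ge 0})$ such that, for all distinct $x_1,\dots,x_k\in\mathbb Z_{\ge 0}$, the random configuration contains all of $x_1,\dots,x_k$ with probability $\det[K(x_i,x_j)]_{i,j=1}^k$. \emph{Hahn ensembles.} Let $a,b>-1$ and let $N\le M$ be non-negative integers. Put $$W(x)=\frac{\Gamma(a+x+1)\,\Gamma(b+M-x+1)}{x!\,\Gamma(a+1)\,(M-x)!\,\Gamma(b+1)},\qquad x=0,1,\dots,M,$$ and $W(x)=0$ for $x>M$, and let $\widetilde P_0,\dots,\widetilde P_M$ be the orthonormal polynomials with weight $W$ on $\{0,\dots,M\}$ (the normalized Hahn polynomials). The $N$-particle Hahn ensemble $\mathrm{Hahn}(N,a,b,M)$ is the determinantal measure with kernel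 $$K_N(x,y)=\bigl(W(x)W(y)\bigr)^{1/2}\sum_{n=0}^{N-1}\widetilde P_n(x)\widetilde P_n(y);$$ it is regarded as a measure on $\mathrm{Conf}(\mathbb Z_{\ge 0})$. \emph{Discrete Laguerre ensemble.} Let $r,\beta>0$ and let $\widetilde L_0,\widetilde L_1,\dots$ be the orthonormal polynomials, with positive leading coefficients, with respect to the weight $t^{\beta-1}e^{-t}\,dt$ on $(0,+\infty)$. The ensemble $\mathrm{DL}^-(r;\beta)$ is the determinantal measure with kernel $$K(x,y)=\int_0^r\widetilde L_x(t)\,\widetilde L_y(t)\,t^{\beta-1}e^{-t}\,dt,\qquad x,y\in\mathbb Z_{\ge 0}.$$ Fix $r>0$, $a>-1$ and $b>-1$, and let $M=M(N)$ be non-negative integers with $M(N)\sim r^{-1}N^2$ as $N\to\infty$. Then the measures $\mathrm{Hahn}(N,a,b,M(N))$ (for every $N$ with $N\le M(N)$, hence for all large $N$) and $\mathrm{DL}^-(r;a+1)$ exist, and, as $N\to\infty$, $\mathrm{Hahn}(N,a,b,M(N))$ converges weakly to $\mathrm{DL}^-(r;a+1)$. -/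

import Mathlib

open MeasureTheory Filter Topology Polynomial Asymptotics

/-- Point configurations in `ℤ_{≥0}`: a subset `X ⊆ ℕ` is represented by its indicator function, so
that the space of configurations is `{0,1}^ℕ` with the (compact, metrizable) product topology and
its Borel σ-algebra. -/
abbrev Conf : Type := ℕ → Bool

/-- The cylinder set of the configurations that contain the given finite set `Y`. -/
def cylinderSet (Y : Finset ℕ) : Set Conf := {X | ∀ x ∈ Y, X x = true}

/-- `P` is a determinantal measure with correlation kernel `K` (with respect to the counting measure
on `ℕ`): the probability that the random configuration contains the distinct points `x₁, …, x_k` is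
`det [K(xᵢ, xⱼ)]`, for every finite set of points. -/
def IsDeterminantal (K : ℕ → ℕ → ℝ) (P : ProbabilityMeasure Conf) : Prop :=
  ∀ Y : Finset ℕ, (P : Measure Conf).real (cylinderSet Y) =
    (Matrix.of fun x y : Y => K x y).det

/-- A kernel is the correlation kernel of at most one determinantal measure. -/
theorem IsDeterminantal.unique {K : ℕ → ℕ → ℝ} {P Q : ProbabilityMeasure Conf}
    (hP : IsDeterminantal K P) (hQ : IsDeterminantal K Q) : P = Q := by
  have hm : ∀ Y, MeasurableSet (cylinderSet Y) := by
    intro Y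
    have : cylinderSet Y = ⋂ x ∈ Y, (fun X : Conf => X x) ⁻¹' {true} := by
      ext X; simp [cylinderSet]
    rw [this]
    exact Finset.measurableSet_biInter _ fun x _ => measurable_pi_apply x (measurableSet_singleton _)
  have hgen : (inferInstance : MeasurableSpace Conf)
      = MeasurableSpace.generateFrom (Set.range cylinderSet) := by
    apply le_antisymm
    · refine iSup_le fun x => ?_
      rw [← measurable_iff_comap_le]
      refine @measurable_to_bool _ (MeasurableSpace.generateFrom (Set.range cylinderSet)) _ ?_
      refine MeasurableSpace.measurableSet_generateFrom ⟨{x}, ?_⟩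
      ext X; simp [cylinderSet]
    · refine MeasurableSpace.generateFrom_le ?_
      rintro _ ⟨Y, rfl⟩
      exact hm Y
  have hpi : IsPiSystem (Set.range cylinderSet) := by
    rintro _ ⟨Y, rfl⟩ _ ⟨Z, rfl⟩ _
    refine ⟨Y ∪ Z, ?_⟩
    ext X
    simp only [cylinderSet, Finset.mem_union, Set.mem_ofPred_eq, Set.mem_inter_iff]
    exact ⟨fun h => ⟨fun x hx => h x (Or.inl hx), fun x hx => h x (Or.inr hx)⟩,
      fun h x hx => hx.elim (h.1 x) (h.2 x)⟩
  apply Subtype.ext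
  have hPp : IsProbabilityMeasure (P : Measure Conf) := P.2
  have hQp : IsProbabilityMeasure (Q : Measure Conf) := Q.2
  refine ext_of_generate_finite (μ := (P : Measure Conf)) (ν := (Q : Measure Conf))
    (Set.range cylinderSet) hgen ?_ ?_ ?_
  · exact hpi
  · rintro _ ⟨Y, rfl⟩
    exact (measureReal_eq_measureReal_iff).1 ((hP Y).trans (hQ Y).symm)
  · rw [measure_univ, measure_univ]

noncomputable section

/-- The determinantal measure `P_K` with correlation kernel `K`, that is, the unique probability
measure satisfying `IsDeterminantal K` (an arbitrary one if there is none). -/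
def determinantalMeasure (K : ℕ → ℕ → ℝ) : ProbabilityMeasure Conf :=
  Classical.epsilon fun P => IsDeterminantal K P

/-- The inner product `∫ p q dμ` of polynomials in `L²(ℝ, μ)`. -/
def polyInner (μ : Measure ℝ) (p q : ℝ[X]) : ℝ := ∫ t, p.eval t * q.eval t ∂μ

/-- The monic orthogonal polynomials with weight measure `μ`, obtained from `1, t, t², …` by the
Gram–Schmidt process. -/
def monicOrthPoly (μ : Measure ℝ) (n : ℕ) : ℝ[X] :=
  X ^ n - ∑ k : Fin n,
    C (polyInner μ (X ^ n) (monicOrthPoly μ k) /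
      polyInner μ (monicOrthPoly μ k) (monicOrthPoly μ k)) * monicOrthPoly μ k
termination_by n
decreasing_by exact k.2

/-- The orthonormal polynomials, with positive leading coefficients, with weight measure `μ`. -/
def orthonormalPoly (μ : Measure ℝ) (n : ℕ) : ℝ[X] :=
  C (1 / √(polyInner μ (monicOrthPoly μ n) (monicOrthPoly μ n))) * monicOrthPoly μ n

/-- The weight function of the Hahn polynomials on `{0, …, M}`, extended by zero to `ℕ`. -/
def hahnWeight (a b : ℝ) (M x : ℕ) : ℝ :=
  if x ≤ M then
    Real.Gamma (a + x + 1) * Real.Gamma (b + M - x + 1) /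
      (x.factorial * Real.Gamma (a + 1) * ((M - x).factorial * Real.Gamma (b + 1)))
  else 0

/-- The weight measure of the Hahn polynomials, as a measure on `ℝ` supported by `{0, …, M}`. -/
def hahnMeasure (a b : ℝ) (M : ℕ) : Measure ℝ :=
  ∑ x ∈ Finset.range (M + 1), ENNReal.ofReal (hahnWeight a b M x) • Measure.dirac (x : ℝ)

/-- The kernel, with respect to the counting measure, of the orthogonal projection onto the
polynomials of degree less than `N` in the Hahn polynomial setting (the Christoffel–Darboux kernel
multiplied by `(W(x)W(y))^{1/2}`); it vanishes when `x` or `y` is outside `{0, …, M}`. -/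
def hahnKernel (N : ℕ) (a b : ℝ) (M x y : ℕ) : ℝ :=
  √(hahnWeight a b M x * hahnWeight a b M y) *
    ∑ n ∈ Finset.range N, (orthonormalPoly (hahnMeasure a b M) n).eval (x : ℝ) *
      (orthonormalPoly (hahnMeasure a b M) n).eval (y : ℝ)

/-- The `N`-particle Hahn ensemble, where `N ≤ M`, as a random subset of `{0, …, M} ⊆ ℕ`. -/
def hahnEnsemble (N : ℕ) (a b : ℝ) (M : ℕ) : ProbabilityMeasure Conf :=
  determinantalMeasure (hahnKernel N a b M)

/-- The weight measure `t^{β-1} e^{-t} dt` on `(0, ∞)` of the Laguerre polynomials. -/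
def laguerreMeasure (β : ℝ) : Measure ℝ :=
  (volume.restrict (Set.Ioi 0)).withDensity
    fun t => ENNReal.ofReal (t ^ (β - 1) * Real.exp (-t))

/-- The discrete kernel `K⁻_r(x, y)`, the integral over `(-∞, r)` of the product of the orthonormal
polynomials with indices `x` and `y`, associated with a weight measure `μ`. -/
def discreteKernelMinus (μ : Measure ℝ) (r : ℝ) (x y : ℕ) : ℝ :=
  ∫ t in Set.Iio r, (orthonormalPoly μ x).eval t * (orthonormalPoly μ y).eval t ∂μ

/-- The discrete Laguerre ensemble `DL⁻(r; β)`. -/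
def discreteLaguerreMinus (r β : ℝ) : ProbabilityMeasure Conf :=
  determinantalMeasure (discreteKernelMinus (laguerreMeasure β) r)

end

/-! ### Determinantal measures with projection kernels -/

theorem Matrix.det_one_add_nonneg_of_transpose_mul_self {n : Type*} [Fintype n] [DecidableEq n]
    {O : Matrix n n ℝ} (hO : O.transpose * O = 1) : 0 ≤ (1 + O).det := by
  have hcont : ContinuousOn (fun s : ℝ => (1 + s • O).det) (Set.Icc 0 1) := by
    refine Continuous.continuousOn (Continuous.matrix_det ?_)
    fun_prop
  by_contra hneg
  push Not at hneg
  have hmem : (0 : ℝ) ∈ Set.Ioo ((1 + (1 : ℝ) • O).det) ((1 + (0 : ℝ) • O).det) := by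
    simpa using hneg
  obtain ⟨s, ⟨hs0, hs1⟩, hs⟩ := intermediate_value_Ioo' zero_le_one hcont hmem
  obtain ⟨v, hv, hv0⟩ := Matrix.exists_mulVec_eq_zero_iff.2 hs
  have hOv : dotProduct (O.mulVec v) (O.mulVec v) = dotProduct v v := by
    rw [Matrix.dotProduct_mulVec, Matrix.vecMul_mulVec, ← Matrix.dotProduct_mulVec, hO,
      Matrix.one_mulVec]
  have hv1 : v = -(s • O.mulVec v) := by
    rw [Matrix.add_mulVec, Matrix.one_mulVec, Matrix.smul_mulVec] at hv0
    exact eq_neg_of_add_eq_zero_left hv0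
  have h1 : dotProduct v v = s ^ 2 * dotProduct v v := by
    conv_lhs => rw [hv1]
    rw [neg_dotProduct_neg, smul_dotProduct, dotProduct_smul, hOv]
    simp only [smul_eq_mul]; ring
  have h2 : 0 < dotProduct v v := by
    have h := dotProduct_star_self_pos_iff.2 hv
    simpa using h
  nlinarith [mul_pos h2 (show (0 : ℝ) < 1 - s ^ 2 by nlinarith)]

/-- For a symmetric idempotent matrix `K`, the matrix that has some of its rows replaced by the
rows of `1 - K` has nonnegative determinant. -/
theorem Matrix.det_piecewise_one_sub_nonneg {n : Type*} [Fintype n] [DecidableEq n]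
    {K : Matrix n n ℝ} (hs : K.transpose = K) (hK : K * K = K) (s : Finset n) :
    0 ≤ (Matrix.of (s.piecewise (1 - K) K)).det := by
  set S : Matrix n n ℝ := Matrix.diagonal fun x => if x ∈ s then -1 else 1 with hS
  have hSS : S * S = 1 := by
    rw [hS, Matrix.diagonal_mul_diagonal, ← Matrix.diagonal_one]
    congr 1
    ext x
    split_ifs <;> simp
  have hST : S.transpose = S := by simp [hS]
  have hTT : (2 • K - 1) * (2 • K - 1) = 1 := by
    simp only [two_smul, sub_mul, mul_sub, add_mul, mul_add, hK, one_mul, mul_one]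
    abel
  have hO : (S * (2 • K - 1)).transpose * (S * (2 • K - 1)) = 1 := by
    rw [Matrix.transpose_mul, hST, Matrix.transpose_sub, Matrix.transpose_smul, hs,
      Matrix.transpose_one, mul_assoc, ← mul_assoc S, hSS, one_mul, hTT]
  have hA : Matrix.of (s.piecewise (1 - K) K) = (2⁻¹ : ℝ) • (1 + S * (2 • K - 1)) := by
    ext i j
    simp only [Matrix.of_apply, Matrix.smul_apply, Matrix.add_apply, hS, Matrix.diagonal_mul,
      Matrix.sub_apply, smul_eq_mul, Finset.piecewise]
    split_ifs
    · refine (Matrix.sub_apply 1 K i j).trans ?_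
      simp; ring
    · simp
  rw [hA, Matrix.det_smul]
  exact mul_nonneg (by positivity) (Matrix.det_one_add_nonneg_of_transpose_mul_self hO)

theorem Matrix.det_piecewise_compl_one {n : Type*} [Fintype n] [DecidableEq n]
    (K : Matrix n n ℝ) (t : Finset n) :
    (Matrix.of (tᶜ.piecewise (1 : Matrix n n ℝ) K)).det
      = (K.submatrix (fun i : {a // a ∈ t} => (i : n)) (fun i : {a // a ∈ t} => (i : n))).det := by
  rw [Matrix.twoBlockTriangular_det _ (fun i => i ∈ t)]
  · have h1 : (Matrix.of (tᶜ.piecewise (1 : Matrix n n ℝ) K)).toSquareBlockProp (fun i => ¬ i ∈ t)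
        = 1 := by
      ext i j
      simp [Matrix.toSquareBlockProp, Finset.piecewise, i.2, Matrix.one_apply, Subtype.ext_iff]
    have h2 : (Matrix.of (tᶜ.piecewise (1 : Matrix n n ℝ) K)).toSquareBlockProp (fun i => i ∈ t)
        = K.submatrix (fun i : {a // a ∈ t} => (i : n)) (fun i : {a // a ∈ t} => (i : n)) := by
      ext i j
      simp [Matrix.toSquareBlockProp, Finset.piecewise, i.2]
    rw [h1, h2, Matrix.det_one, mul_one]
    congr!
  · intro i hi j hj
    have : i ≠ j := fun h => hi (h ▸ hj)
    simp [Finset.piecewise, hi, this]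

theorem measurableSet_cylinderSet (Y : Finset ℕ) : MeasurableSet (cylinderSet Y) := by
  have : cylinderSet Y = ⋂ x ∈ Y, (fun X : Conf => X x) ⁻¹' {true} := by
    ext X; simp [cylinderSet]
  rw [this]
  exact Finset.measurableSet_biInter _ fun x _ => measurable_pi_apply x (measurableSet_singleton _)

/-- A symmetric idempotent kernel supported by a finite set is the correlation kernel of a
determinantal measure. -/
theorem exists_isDeterminantal_of_idempotent (E : Finset ℕ) (K : ℕ → ℕ → ℝ)
    (hs : ∀ x y, K x y = K y x) (h0 : ∀ x y, x ∉ E → K x y = 0)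
    (hK : ∀ x ∈ E, ∀ z ∈ E, ∑ y ∈ E, K x y * K y z = K x z) :
    ∃ P, IsDeterminantal K P := by
  classical
  set A : Matrix E E ℝ := Matrix.of fun x y => K x y with hA
  have hAs : A.transpose = A := by ext x y; exact hs _ _
  have hAA : A * A = A := by
    ext x z
    rw [Matrix.mul_apply]
    simp only [hA, Matrix.of_apply]
    rw [Finset.sum_coe_sort E (fun y => K x y * K y z)]
    exact hK _ x.2 _ z.2
  set B : Matrix E E ℝ := 1 - A with hB
  set p : Finset E → ℝ := fun s => (Matrix.of (s.piecewise B A)).det with hp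
  have hp0 : ∀ s, 0 ≤ p s := Matrix.det_piecewise_one_sub_nonneg hAs hAA
  have hsum : ∀ t : Finset E, ∑ s ∈ tᶜ.powerset, p s =
      (A.submatrix (fun i : {a // a ∈ t} => (i : E)) (fun i : {a // a ∈ t} => (i : E))).det := by
    intro t
    rw [← Matrix.det_piecewise_compl_one]
    have h := (Matrix.detRowAlternating (n := E) (R := ℝ)).toMultilinearMap.map_piecewise_add
      B A tᶜ
    have hBA : B + A = 1 := sub_add_cancel 1 A
    refine Eq.trans h.symm (congrArg (fun C : Matrix E E ℝ =>
      (Matrix.of (tᶜ.piecewise C A)).det) hBA)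
  let c : Finset E → Conf := fun s n => decide (∃ h : n ∈ E, (⟨n, h⟩ : E) ∉ s)
  let P : Measure Conf := ∑ s : Finset E, ENNReal.ofReal (p s) • Measure.dirac (c s)
  have hP : ∀ Y, P (cylinderSet Y)
      = ∑ s : Finset E, ENNReal.ofReal (if c s ∈ cylinderSet Y then p s else 0) := by
    intro Y
    simp only [P, Measure.coe_finsetSum, Finset.sum_apply, Measure.smul_apply, smul_eq_mul]
    refine Finset.sum_congr rfl fun s _ => ?_
    rw [Measure.dirac_apply' _ (measurableSet_cylinderSet Y)]
    by_cases h : c s ∈ cylinderSet Y <;> simp [h]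
  have hPr : ∀ Y, P.real (cylinderSet Y) = (Matrix.of fun x y : Y => K x y).det := by
    intro Y
    rw [Measure.real, hP, ← ENNReal.ofReal_sum_of_nonneg (fun s _ => by split_ifs <;> simp [hp0]),
      ENNReal.toReal_ofReal (Finset.sum_nonneg (fun s _ => by split_ifs <;> simp [hp0]))]
    by_cases hY : Y ⊆ E
    · set t : Finset E := Y.subtype (· ∈ E) with ht
      have hc : ∀ s, c s ∈ cylinderSet Y ↔ s ∈ tᶜ.powerset := by
        intro s
        simp only [c, cylinderSet, Set.mem_ofPred_eq, decide_eq_true_eq, Finset.mem_powerset,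
          Finset.subset_iff, Finset.mem_compl, ht, Finset.mem_subtype]
        constructor
        · intro h x hx hxY
          obtain ⟨_, h2⟩ := h x hxY
          exact h2 hx
        · intro h x hx
          exact ⟨hY hx, fun h2 => h h2 hx⟩
      rw [← Finset.sum_filter]
      have : Finset.univ.filter (fun s => c s ∈ cylinderSet Y) = tᶜ.powerset := by
        ext s; rw [Finset.mem_filter, hc]; simp
      rw [this, hsum]
      let e : Y ≃ {a : E // a ∈ t} :=
        { toFun := fun y => ⟨⟨y, hY y.2⟩, by simp [ht]⟩
          invFun := fun a => ⟨(a : E), Finset.mem_subtype.1 a.2⟩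
          left_inv := fun y => rfl
          right_inv := fun a => rfl }
      rw [← Matrix.det_submatrix_equiv_self e]
      rfl
    · obtain ⟨x, hx, hxE⟩ := Finset.not_subset.1 hY
      rw [Matrix.det_eq_zero_of_row_eq_zero (⟨x, hx⟩ : Y) (fun j => h0 _ _ hxE)]
      refine Finset.sum_eq_zero fun s _ => if_neg fun h => ?_
      have := h x hx
      simp [c, hxE] at this
  have huniv : cylinderSet ∅ = Set.univ := by ext; simp [cylinderSet]
  have hprob : IsProbabilityMeasure P := by
    constructor
    have h1 := hPr ∅
    rw [huniv, Matrix.det_isEmpty] at h1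
    rw [Measure.real, ENNReal.toReal_eq_one_iff] at h1
    exact h1
  exact ⟨⟨P, hprob⟩, hPr⟩

/-! ### Weak convergence of determinantal measures -/

theorem isClopen_cylinderSet (Y : Finset ℕ) : IsClopen (cylinderSet Y) := by
  have : cylinderSet Y = ⋂ x ∈ Y, (fun X : Conf => X x) ⁻¹' {true} := by
    ext X; simp [cylinderSet]
  rw [this]
  exact isClopen_biInter_finset fun x _ => (isClopen_discrete {true}).preimage (continuous_apply x)

/-- If the correlation functions of determinantal measures converge to the minors of a kernel `K`,
then `K` is the correlation kernel of a determinantal measure, and the measures converge to it. -/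
theorem exists_isDeterminantal_tendsto {K : ℕ → ℕ → ℝ} {KN : ℕ → ℕ → ℕ → ℝ}
    {P : ℕ → ProbabilityMeasure Conf} (hP : ∀ᶠ N in atTop, IsDeterminantal (KN N) (P N))
    (h : ∀ Y : Finset ℕ, Tendsto (fun N => (Matrix.of fun x y : Y => KN N x y).det) atTop
      (𝓝 (Matrix.of fun x y : Y => K x y).det)) :
    ∃ Q, IsDeterminantal K Q ∧ Tendsto P atTop (𝓝 Q) := by
  have hcont : ∀ Y, Continuous
      fun Q : ProbabilityMeasure Conf => (Q : Measure Conf).real (cylinderSet Y) := by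
    intro Y
    rw [continuous_iff_continuousAt]
    intro Q
    have := ProbabilityMeasure.tendsto_measure_of_isClopen_of_tendsto
      (tendsto_id (x := 𝓝 Q)) (isClopen_cylinderSet Y)
    exact (NNReal.continuous_coe.tendsto _).comp this
  have hlim : ∀ Y, Tendsto (fun N => (P N : Measure Conf).real (cylinderSet Y)) atTop
      (𝓝 (Matrix.of fun x y : Y => K x y).det) := fun Y =>
    (h Y).congr' (hP.mono fun N hN => (hN Y).symm)
  have hclus : ∀ Q, MapClusterPt Q atTop P → IsDeterminantal K Q := by
    intro Q hQ Y
    have h1 := hQ.tendsto_comp ((hcont Y).tendsto Q)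
    exact eq_of_nhds_neBot (NeBot.mono h1 (inf_le_inf le_rfl (hlim Y)))
  obtain ⟨Q, hQ⟩ : ∃ Q, MapClusterPt Q atTop P := by
    obtain ⟨Q, -, hQ⟩ := isCompact_univ (X := ProbabilityMeasure Conf)
      (f := map P atTop) (by simp)
    exact ⟨Q, hQ⟩
  refine ⟨Q, hclus Q hQ, tendsto_nhds_of_unique_mapClusterPt fun Q' hQ' => ?_⟩
  exact (hclus Q' hQ').unique (hclus Q hQ)

theorem IsDeterminantal.determinantalMeasure {K : ℕ → ℕ → ℝ} (h : ∃ P, IsDeterminantal K P) :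
    IsDeterminantal K (determinantalMeasure K) :=
  Classical.epsilon_spec h

theorem Matrix.det_of_gauge {ι : Type*} [Fintype ι] [DecidableEq ι] (e : ι → ℝ)
    (he : ∀ i, e i * e i = 1) (K : ι → ι → ℝ) :
    (Matrix.of fun i j => e i * e j * K i j).det = (Matrix.of K).det := by
  have : (Matrix.of fun i j => e i * e j * K i j)
      = Matrix.diagonal e * Matrix.of K * Matrix.diagonal e := by
    ext i j
    simp only [Matrix.of_apply, Matrix.mul_diagonal, Matrix.diagonal_mul]
    ring
  rw [this, Matrix.det_mul, Matrix.det_mul, Matrix.det_diagonal, mul_right_comm,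
    ← Finset.prod_mul_distrib]
  simp [he]

/-! ### Orthonormal polynomials -/

section OrthPoly

variable {μ : Measure ℝ}

theorem polyInner_comm (p q : ℝ[X]) : polyInner μ p q = polyInner μ q p := by
  simp only [polyInner, mul_comm]

theorem polyInner_C_mul_left (c : ℝ) (p q : ℝ[X]) :
    polyInner μ (C c * p) q = c * polyInner μ p q := by
  simp only [polyInner, eval_mul, eval_C, mul_assoc, integral_const_mul]

theorem polyInner_C_mul_right (c : ℝ) (p q : ℝ[X]) :
    polyInner μ p (C c * q) = c * polyInner μ p q := by
  rw [polyInner_comm, polyInner_C_mul_left, polyInner_comm]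

variable (hμ : ∀ p : ℝ[X], Integrable (fun t => p.eval t) μ)
include hμ

theorem polyInner_sub_left (p₁ p₂ q : ℝ[X]) :
    polyInner μ (p₁ - p₂) q = polyInner μ p₁ q - polyInner μ p₂ q := by
  have h1 := hμ (p₁ * q)
  have h2 := hμ (p₂ * q)
  simp only [eval_mul] at h1 h2
  simp only [polyInner, eval_sub, sub_mul, integral_sub h1 h2]

theorem polyInner_sum_left {ι : Type*} (s : Finset ι) (p : ι → ℝ[X]) (q : ℝ[X]) :
    polyInner μ (∑ i ∈ s, p i) q = ∑ i ∈ s, polyInner μ (p i) q := by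
  simp only [polyInner, eval_finsetSum, Finset.sum_mul]
  refine integral_finsetSum _ fun i _ => ?_
  simpa only [eval_mul] using hμ (p i * q)

/-- Expansion of a polynomial with respect to monic orthogonal polynomials. -/
theorem eq_sum_of_degree_lt {m : ℕ} {q : ℕ → ℝ[X]} (hq : ∀ n ≤ m, (q n).Monic)
    (hd : ∀ n ≤ m, (q n).natDegree = n)
    (ho : ∀ i ≤ m, ∀ j ≤ m, i ≠ j → polyInner μ (q i) (q j) = 0)
    (hpos : ∀ i ≤ m, polyInner μ (q i) (q i) ≠ 0) (n : ℕ) (hn : n ≤ m + 1) (p : ℝ[X])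
    (hp : p.degree < n) :
    p = ∑ k ∈ Finset.range n, C (polyInner μ p (q k) / polyInner μ (q k) (q k)) * q k := by
  induction n generalizing p with
  | zero =>
    have : p = 0 := by simpa using hp
    simp [this]
  | succ n ih =>
    have hnm : n ≤ m := by omega
    set p' := p - C (p.coeff n) * q n with hp'
    have hdeg : p'.degree < n := by
      rw [degree_lt_iff_coeff_zero] at hp ⊢
      intro k hk
      rw [hp', coeff_sub, coeff_C_mul]
      rcases hk.eq_or_lt with rfl | hk
      · have h1 := hq _ hnm
        rw [Monic, leadingCoeff, hd _ hnm] at h1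
        simp [h1]
      · rw [hp k hk, coeff_eq_zero_of_natDegree_lt (p := q n) (by rw [hd _ hnm]; exact hk)]
        simp
    have h1 := ih (by omega) p' hdeg
    have h2 : polyInner μ p' (q n) = 0 := by
      rw [h1, polyInner_sum_left hμ]
      refine Finset.sum_eq_zero fun k hk => ?_
      have hk := Finset.mem_range.1 hk
      rw [polyInner_C_mul_left, ho k (by omega) n hnm hk.ne, mul_zero]
    have h3 : polyInner μ p (q n) = p.coeff n * polyInner μ (q n) (q n) := by
      rw [hp', polyInner_sub_left hμ, polyInner_C_mul_left] at h2
      linarith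
    have h4 : ∀ k ∈ Finset.range n, polyInner μ p' (q k) = polyInner μ p (q k) := by
      intro k hk
      have hk := Finset.mem_range.1 hk
      rw [hp', polyInner_sub_left hμ, polyInner_C_mul_left, ho n hnm k (by omega) hk.ne',
        mul_zero, sub_zero]
    rw [Finset.sum_range_succ, h3, mul_div_cancel_right₀ _ (hpos n hnm)]
    rw [Finset.sum_congr rfl fun k hk => by rw [h4 k hk]] at h1
    rw [← h1, hp']
    ring

theorem monicOrthPoly_eq {m : ℕ} {q : ℕ → ℝ[X]} (hq : ∀ n ≤ m, (q n).Monic)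
    (hd : ∀ n ≤ m, (q n).natDegree = n)
    (ho : ∀ i ≤ m, ∀ j ≤ m, i ≠ j → polyInner μ (q i) (q j) = 0)
    (hpos : ∀ i ≤ m, polyInner μ (q i) (q i) ≠ 0) (n : ℕ) (hn : n ≤ m) :
    monicOrthPoly μ n = q n := by
  induction n using Nat.strong_induction_on with
  | _ n ih =>
    rw [monicOrthPoly]
    have h1 : ∑ k : Fin n, C (polyInner μ (X ^ n) (monicOrthPoly μ k) /
        polyInner μ (monicOrthPoly μ k) (monicOrthPoly μ k)) * monicOrthPoly μ k
        = ∑ k ∈ Finset.range n, C (polyInner μ (X ^ n) (q k) / polyInner μ (q k) (q k)) * q k := by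
      rw [← Fin.sum_univ_eq_sum_range
        (fun k => C (polyInner μ (X ^ n) (q k) / polyInner μ (q k) (q k)) * q k)]
      refine Finset.sum_congr rfl fun k _ => ?_
      rw [ih k k.2 (by omega)]
    have hdeg : (X ^ n - q n).degree < (n : WithBot ℕ) := by
      rw [degree_lt_iff_coeff_zero]
      intro k hk
      rw [coeff_sub, coeff_X_pow]
      rcases hk.eq_or_lt with rfl | hk
      · have h1 := hq _ hn
        rw [Monic, leadingCoeff, hd _ hn] at h1
        simp [h1]
      · rw [coeff_eq_zero_of_natDegree_lt (p := q n) (by rw [hd _ hn]; exact hk), if_neg hk.ne', sub_zero]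
    have h2 := eq_sum_of_degree_lt hμ hq hd ho hpos n (by omega) _ hdeg
    rw [h1, sub_eq_iff_eq_add, ← sub_eq_iff_eq_add', h2]
    refine Finset.sum_congr rfl fun k hk => ?_
    have hk := Finset.mem_range.1 hk
    rw [polyInner_sub_left hμ, ho n hn k (by omega) hk.ne', sub_zero]

/-- Orthogonal polynomials of the right degrees are the orthonormal polynomials, up to
normalization. -/
theorem orthonormalPoly_eq {m : ℕ} {q : ℕ → ℝ[X]} (hq : ∀ n ≤ m, (q n).leadingCoeff ≠ 0)
    (hd : ∀ n ≤ m, (q n).natDegree = n)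
    (ho : ∀ i ≤ m, ∀ j ≤ m, i ≠ j → polyInner μ (q i) (q j) = 0)
    (hpos : ∀ i ≤ m, 0 < polyInner μ (q i) (q i)) (n : ℕ) (hn : n ≤ m) :
    orthonormalPoly μ n =
      C (|(q n).leadingCoeff| / (q n).leadingCoeff / √(polyInner μ (q n) (q n))) * q n := by
  have hin : ∀ i j, polyInner μ (C (q i).leadingCoeff⁻¹ * q i) (C (q j).leadingCoeff⁻¹ * q j)
      = (q i).leadingCoeff⁻¹ * (q j).leadingCoeff⁻¹ * polyInner μ (q i) (q j) := fun i j => by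
    rw [polyInner_C_mul_left, polyInner_C_mul_right]; ring
  have h := monicOrthPoly_eq hμ (m := m) (q := fun n => C (q n).leadingCoeff⁻¹ * q n)
    (fun n hn => by
      rw [Monic, leadingCoeff_mul, leadingCoeff_C, inv_mul_cancel₀ (hq n hn)])
    (fun n hn => by
      rw [natDegree_C_mul (inv_ne_zero (hq n hn)), hd n hn])
    (fun i hi j hj hij => by rw [hin, ho i hi j hj hij, mul_zero])
    (fun i hi => by
      have := inv_ne_zero (hq i hi)
      rw [hin]
      exact mul_ne_zero (mul_ne_zero this this) (hpos i hi).ne') n hn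
  have hl := hq n hn
  rw [orthonormalPoly, h, hin, ← mul_assoc, ← C_mul]
  congr 2
  rw [Real.sqrt_mul (mul_self_nonneg _), Real.sqrt_mul_self_eq_abs, abs_inv]
  have : |(q n).leadingCoeff| ≠ 0 := abs_ne_zero.2 hl
  have : √(polyInner μ (q n) (q n)) ≠ 0 := (Real.sqrt_pos.2 (hpos n hn)).ne'
  field_simp

end OrthPoly

/-! ### Hahn polynomials -/

section Hahn

noncomputable section

/-- The eigenvalues `n(n+a+b+1)` of the Hahn difference operator. -/
def hahnEigenvalue (a b : ℝ) (n : ℕ) : ℝ := n * (n + a + b + 1)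

/-- The coefficients of the Hahn polynomials with respect to the basis `x.choose k`. -/
def hahnCoeff (a b : ℝ) (M n k : ℕ) : ℝ :=
  (∏ j ∈ Finset.range k, (hahnEigenvalue a b j - hahnEigenvalue a b n)) /
    ((ascPochhammer ℝ k).eval (a + 1) * M.descFactorial k)

/-- The Hahn polynomials, normalized by the value `1` at `0`. -/
def hahnPoly (a b : ℝ) (M n : ℕ) : ℝ[X] :=
  ∑ k ∈ Finset.range (n + 1), C (hahnCoeff a b M n k / k.factorial) * descPochhammer ℝ k

end

variable {a b : ℝ} {M : ℕ}

theorem hahnEigenvalue_strictMono (ha : -1 < a) (hb : -1 < b) :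
    StrictMono (hahnEigenvalue a b) := by
  refine strictMono_nat_of_lt_succ fun n => ?_
  simp only [hahnEigenvalue]
  push_cast
  have : (0 : ℝ) ≤ n := n.cast_nonneg
  nlinarith

theorem ascPochhammer_eval_add_one_pos (ha : -1 < a) (k : ℕ) :
    0 < (ascPochhammer ℝ k).eval (a + 1) := ascPochhammer_pos k (a + 1) (by linarith)

theorem hahnPoly_eval_natCast (n x : ℕ) : (hahnPoly a b M n).eval (x : ℝ) =
    ∑ k ∈ Finset.range (n + 1), hahnCoeff a b M n k * x.choose k := by
  simp only [hahnPoly, eval_finsetSum, eval_mul, eval_C, descPochhammer_eval_eq_descFactorial]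
  refine Finset.sum_congr rfl fun k _ => ?_
  rw [Nat.descFactorial_eq_factorial_mul_choose]
  push_cast
  field_simp

theorem hahnPoly_eval_zero (n : ℕ) : (hahnPoly a b M n).eval 0 = 1 := by
  have h := hahnPoly_eval_natCast (a := a) (b := b) (M := M) n 0
  rw [Nat.cast_zero] at h
  rw [h, Finset.sum_range_succ']
  simp [hahnCoeff]

theorem hahnCoeff_succ (ha : -1 < a) {n k : ℕ} (hk : k < M) :
    hahnCoeff a b M n (k + 1) * ((a + k + 1) * (M - k)) =
      hahnCoeff a b M n k * (hahnEigenvalue a b k - hahnEigenvalue a b n) := by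
  have h1 := (ascPochhammer_eval_add_one_pos ha k).ne'
  have h2 : (M.descFactorial k : ℝ) ≠ 0 := by
    exact_mod_cast (Nat.descFactorial_pos.2 hk.le).ne'
  have h3 : (M : ℝ) - k ≠ 0 := by
    have : (k : ℝ) < M := by exact_mod_cast hk
    linarith
  have h4 : a + 1 + k ≠ 0 := by
    have : (0 : ℝ) ≤ k := k.cast_nonneg
    linarith
  simp only [hahnCoeff]
  rw [Finset.prod_range_succ, ascPochhammer_succ_eval, Nat.descFactorial_succ, Nat.cast_mul,
    Nat.cast_sub hk.le]
  field_simp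
  ring

theorem hahnPoly_natDegree (ha : -1 < a) (hb : -1 < b) {n : ℕ} (hn : n ≤ M) :
    (hahnPoly a b M n).natDegree = n ∧ (hahnPoly a b M n).leadingCoeff ≠ 0 := by
  have hc : hahnCoeff a b M n n / n.factorial ≠ 0 := by
    refine div_ne_zero (div_ne_zero ?_ (mul_ne_zero ?_ ?_)) (by positivity)
    · refine Finset.prod_ne_zero_iff.2 fun j hj => sub_ne_zero.2 ?_
      exact (hahnEigenvalue_strictMono ha hb (Finset.mem_range.1 hj)).ne
    · exact (ascPochhammer_eval_add_one_pos ha n).ne'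
    · exact_mod_cast (Nat.descFactorial_pos.2 hn).ne'
  have hcoef : (hahnPoly a b M n).coeff n ≠ 0 := by
    rw [hahnPoly, Finset.sum_range_succ, coeff_add, coeff_C_mul, finsetSum_coeff,
      Finset.sum_eq_zero]
    · have := monic_descPochhammer ℝ n
      rw [Monic, leadingCoeff, descPochhammer_natDegree] at this
      rw [this]; simpa using hc
    · intro k hk
      rw [coeff_C_mul, coeff_eq_zero_of_natDegree_lt, mul_zero]
      rw [descPochhammer_natDegree]
      exact Finset.mem_range.1 hk
  have hdeg : (hahnPoly a b M n).natDegree = n := by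
    refine le_antisymm ?_ (le_natDegree_of_ne_zero hcoef)
    refine natDegree_sum_le_of_forall_le _ _ fun k hk => ?_
    refine (natDegree_C_mul_le _ _).trans ?_
    rw [descPochhammer_natDegree]
    have := Finset.mem_range.1 hk
    omega
  refine ⟨hdeg, ?_⟩
  rw [leadingCoeff, hdeg]
  exact hcoef

/-- The action of the Hahn difference operator on binomial coefficients. -/
theorem hahn_difference_choose_succ (k x : ℕ) :
    (x + a + 1) * (M - x) * ((x.choose (k + 1) : ℝ) - (x + 1).choose (k + 1)) +
      x * (b + M - x + 1) * (x.choose (k + 1) - (x - 1).choose (k + 1)) =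
    hahnEigenvalue a b (k + 1) * x.choose (k + 1) - (a + k + 1) * (M - k) * x.choose k := by
  have h1 : ((x + 1).choose (k + 1) : ℝ) = x.choose k + x.choose (k + 1) := by
    exact_mod_cast Nat.choose_succ_succ x k
  have h2 : (x : ℝ) * (x.choose (k + 1) - (x - 1).choose (k + 1)) = (k + 1) * x.choose (k + 1) := by
    rcases x with _ | x
    · simp
    · have h3 : ((x + 1).choose (k + 1) : ℝ) = x.choose k + x.choose (k + 1) := by
        exact_mod_cast Nat.choose_succ_succ x k
      have h4 : ((x : ℝ) + 1) * x.choose k = (x + 1).choose (k + 1) * (k + 1) := by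
        exact_mod_cast Nat.add_one_mul_choose_eq x k
      have h5 : ((x + 1 - 1).choose (k + 1) : ℝ) = x.choose (k + 1) := by simp
      rw [h5]
      push_cast
      linear_combination h4 + (↑x + 1) * h3
  have h6 : ((k : ℝ) + 1) * x.choose (k + 1) = (x - k) * x.choose k := by
    have h := Nat.choose_succ_right_eq x k
    rcases le_or_gt k x with hkx | hkx
    · have : (x.choose (k + 1) : ℝ) * (k + 1) = x.choose k * (x - k) := by
        rw [← Nat.cast_sub hkx]; exact_mod_cast h
      linear_combination this
    · simp [Nat.choose_eq_zero_of_lt hkx, Nat.choose_eq_zero_of_lt (hkx.trans (Nat.lt_succ_self k))]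
  rw [h1]
  simp only [hahnEigenvalue]
  push_cast
  linear_combination (b + M - x + 1) * h2 + (M - x - a - k - 1) * h6

/-- The Hahn polynomials are eigenfunctions of the Hahn difference operator. -/
theorem hahn_difference_hahnPoly (ha : -1 < a) {n : ℕ} (hn : n ≤ M) (x : ℕ) :
    (x + a + 1) * (M - x) * ((hahnPoly a b M n).eval (x : ℝ) -
        (hahnPoly a b M n).eval ((x + 1 : ℕ) : ℝ)) +
      x * (b + M - x + 1) * ((hahnPoly a b M n).eval (x : ℝ) -
        (hahnPoly a b M n).eval ((x - 1 : ℕ) : ℝ)) =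
    hahnEigenvalue a b n * (hahnPoly a b M n).eval (x : ℝ) := by
  simp only [hahnPoly_eval_natCast]
  set d := hahnCoeff a b M n with hd
  have key : ∀ m ≤ n, ∑ k ∈ Finset.range (m + 1), d k *
      ((x + a + 1) * (M - x) * ((x.choose k : ℝ) - (x + 1).choose k) +
      x * (b + M - x + 1) * (x.choose k - (x - 1).choose k)) =
      hahnEigenvalue a b n * ∑ k ∈ Finset.range (m + 1), d k * x.choose k +
      d m * (hahnEigenvalue a b m - hahnEigenvalue a b n) * x.choose m := by
    intro m hm
    induction m with
    | zero => simp [hahnEigenvalue]; ring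
    | succ m ih =>
      have h1 := hahnCoeff_succ (b := b) (n := n) ha (show m < M by omega)
      rw [Finset.sum_range_succ, ih (by omega), hahn_difference_choose_succ,
        Finset.sum_range_succ _ (m + 1)]
      rw [← hd] at h1
      linear_combination -(x.choose m : ℝ) * h1
  have h := key n le_rfl
  rw [sub_self, mul_zero, zero_mul, add_zero] at h
  rw [← h]
  simp only [Finset.mul_sum, ← Finset.sum_sub_distrib, ← Finset.sum_add_distrib]
  refine Finset.sum_congr rfl fun k _ => ?_
  ring

theorem hahnWeight_pos (ha : -1 < a) (hb : -1 < b) {x : ℕ} (hx : x ≤ M) :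
    0 < hahnWeight a b M x := by
  have h1 : (0 : ℝ) ≤ x := x.cast_nonneg
  have h2 : (x : ℝ) ≤ M := by exact_mod_cast hx
  rw [hahnWeight, if_pos hx]
  have := Real.Gamma_pos_of_pos (show 0 < a + x + 1 by linarith)
  have := Real.Gamma_pos_of_pos (show 0 < b + M - x + 1 by linarith)
  have := Real.Gamma_pos_of_pos (show 0 < a + 1 by linarith)
  have := Real.Gamma_pos_of_pos (show 0 < b + 1 by linarith)
  positivity

theorem hahnWeight_nonneg (ha : -1 < a) (hb : -1 < b) (x : ℕ) : 0 ≤ hahnWeight a b M x := by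
  by_cases hx : x ≤ M
  · exact (hahnWeight_pos ha hb hx).le
  · simp [hahnWeight, hx]

theorem hahnWeight_succ (ha : -1 < a) (hb : -1 < b) {x : ℕ} (hx : x < M) :
    hahnWeight a b M (x + 1) * ((x + 1) * (b + M - x)) =
      hahnWeight a b M x * ((x + a + 1) * (M - x)) := by
  have h1 : (0 : ℝ) ≤ x := x.cast_nonneg
  have h2 : (x : ℝ) + 1 ≤ M := by exact_mod_cast hx
  rw [hahnWeight, if_pos (Nat.succ_le_of_lt hx), hahnWeight, if_pos hx.le]
  have e1 : Real.Gamma (a + (x + 1 : ℕ) + 1) = (a + x + 1) * Real.Gamma (a + x + 1) := by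
    rw [← Real.Gamma_add_one (by linarith)]; congr 1; push_cast; ring
  have e2 : Real.Gamma (b + M - x + 1) = (b + M - x) * Real.Gamma (b + M - (x + 1 : ℕ) + 1) := by
    have : b + M - (x + 1 : ℕ) + 1 = b + M - x := by push_cast; ring
    rw [this, ← Real.Gamma_add_one (by linarith)]
  have e3 : ((M - x).factorial : ℝ) = (M - x) * (M - (x + 1)).factorial := by
    have : M - x = (M - (x + 1)) + 1 := by omega
    rw [this, Nat.factorial_succ]
    push_cast [Nat.cast_sub hx]
    ring
  rw [e1, e2, e3, Nat.factorial_succ]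
  have := (Real.Gamma_pos_of_pos (show 0 < a + 1 by linarith)).ne'
  have := (Real.Gamma_pos_of_pos (show 0 < b + 1 by linarith)).ne'
  have : (M : ℝ) - x ≠ 0 := by linarith
  push_cast
  field_simp
  ring

/-- Discrete Green formula for the Hahn difference operator. -/
theorem hahn_green (ha : -1 < a) (hb : -1 < b) (f g : ℕ → ℝ) (m : ℕ) (hm : m ≤ M) :
    ∑ x ∈ Finset.range (m + 1), hahnWeight a b M x *
      (((x + a + 1) * (M - x) * (f x - f (x + 1)) + x * (b + M - x + 1) * (f x - f (x - 1))) * g x -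
      f x * ((x + a + 1) * (M - x) * (g x - g (x + 1)) +
        x * (b + M - x + 1) * (g x - g (x - 1)))) =
    hahnWeight a b M m * ((m + a + 1) * (M - m)) * (f m * g (m + 1) - f (m + 1) * g m) := by
  induction m with
  | zero => simp; ring
  | succ m ih =>
    rw [Finset.sum_range_succ, ih (by omega), ← hahnWeight_succ ha hb (by omega),
      Nat.add_sub_cancel]
    push_cast
    ring

theorem integrable_hahnMeasure (f : ℝ → ℝ) : Integrable f (hahnMeasure a b M) := by
  rw [hahnMeasure, integrable_finsetSum_measure]
  intro x _
  refine Integrable.smul_measure ?_ ENNReal.ofReal_ne_top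
  exact integrable_dirac (by simp)

theorem polyInner_hahnMeasure (ha : -1 < a) (hb : -1 < b) (p q : ℝ[X]) :
    polyInner (hahnMeasure a b M) p q = ∑ x ∈ Finset.range (M + 1),
      hahnWeight a b M x * (p.eval (x : ℝ) * q.eval (x : ℝ)) := by
  have h := integrable_hahnMeasure (a := a) (b := b) (M := M) fun t => p.eval t * q.eval t
  rw [hahnMeasure, integrable_finsetSum_measure] at h
  rw [polyInner, hahnMeasure, integral_finsetSum_measure h]
  refine Finset.sum_congr rfl fun x _ => ?_
  rw [integral_smul_measure, integral_dirac, ENNReal.toReal_ofReal (hahnWeight_nonneg ha hb x),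
    smul_eq_mul]

theorem polyInner_hahnPoly_of_ne (ha : -1 < a) (hb : -1 < b) {m n : ℕ} (hm : m ≤ M) (hn : n ≤ M)
    (hmn : m ≠ n) :
    polyInner (hahnMeasure a b M) (hahnPoly a b M m) (hahnPoly a b M n) = 0 := by
  have h := hahn_green ha hb (fun x => (hahnPoly a b M m).eval (x : ℝ))
    (fun x => (hahnPoly a b M n).eval (x : ℝ)) M le_rfl
  simp only [hahn_difference_hahnPoly ha hm, hahn_difference_hahnPoly ha hn, sub_self, mul_zero,
    zero_mul] at h
  have hne : hahnEigenvalue a b m - hahnEigenvalue a b n ≠ 0 :=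
    sub_ne_zero.2 ((hahnEigenvalue_strictMono ha hb).injective.ne hmn)
  refine (mul_eq_zero.1 ?_).resolve_left hne
  rw [polyInner_hahnMeasure ha hb, Finset.mul_sum, ← h]
  refine Finset.sum_congr rfl fun x _ => ?_
  ring

theorem polyInner_hahnPoly_pos (ha : -1 < a) (hb : -1 < b) (n : ℕ) :
    0 < polyInner (hahnMeasure a b M) (hahnPoly a b M n) (hahnPoly a b M n) := by
  rw [polyInner_hahnMeasure ha hb]
  refine Finset.sum_pos' (fun x _ => mul_nonneg (hahnWeight_nonneg ha hb x) (mul_self_nonneg _))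
    ⟨0, by simp, ?_⟩
  rw [Nat.cast_zero, hahnPoly_eval_zero]
  simpa using hahnWeight_pos ha hb (Nat.zero_le M)

end Hahn

section HahnEnsemble

variable {a b : ℝ} {M : ℕ}

theorem orthonormalPoly_hahnMeasure_eval_mul_eval (ha : -1 < a) (hb : -1 < b) {n : ℕ} (hn : n ≤ M)
    (s t : ℝ) :
    (orthonormalPoly (hahnMeasure a b M) n).eval s * (orthonormalPoly (hahnMeasure a b M) n).eval t =
      (hahnPoly a b M n).eval s * (hahnPoly a b M n).eval t /
        polyInner (hahnMeasure a b M) (hahnPoly a b M n) (hahnPoly a b M n) := by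
  have hpos := polyInner_hahnPoly_pos (M := M) ha hb n
  have hl := (hahnPoly_natDegree ha hb hn).2
  rw [orthonormalPoly_eq (fun p => integrable_hahnMeasure _)
    (fun n hn => (hahnPoly_natDegree ha hb hn).2) (fun n hn => (hahnPoly_natDegree ha hb hn).1)
    (fun i hi j hj hij => polyInner_hahnPoly_of_ne ha hb hi hj hij)
    (fun i _ => polyInner_hahnPoly_pos ha hb i) n hn]
  simp only [eval_mul, eval_C]
  set l := (hahnPoly a b M n).leadingCoeff
  set h := polyInner (hahnMeasure a b M) (hahnPoly a b M n) (hahnPoly a b M n)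
  have h1 : √h * √h = h := Real.mul_self_sqrt hpos.le
  have h2 : |l| * |l| = l * l := abs_mul_abs_self l
  have h3 : √h ≠ 0 := (Real.sqrt_pos.2 hpos).ne'
  have h4 : h ≠ 0 := hpos.ne'
  calc _ = (|l| * |l|) / (l * l) / (√h * √h) *
        ((hahnPoly a b M n).eval s * (hahnPoly a b M n).eval t) := by field_simp
    _ = _ := by rw [h1, h2]; field_simp

theorem orthonormalPoly_hahnMeasure_orthonormal (ha : -1 < a) (hb : -1 < b) {m n : ℕ}
    (hm : m ≤ M) (hn : n ≤ M) :
    ∑ x ∈ Finset.range (M + 1), hahnWeight a b M x *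
      ((orthonormalPoly (hahnMeasure a b M) m).eval (x : ℝ) *
        (orthonormalPoly (hahnMeasure a b M) n).eval (x : ℝ)) = if m = n then 1 else 0 := by
  have hE : ∀ n ≤ M, _ := fun n hn =>
    orthonormalPoly_eq (fun p => integrable_hahnMeasure _)
    (fun n hn => (hahnPoly_natDegree ha hb hn).2) (fun n hn => (hahnPoly_natDegree ha hb hn).1)
    (fun i hi j hj hij => polyInner_hahnPoly_of_ne ha hb hi hj hij)
    (fun i _ => polyInner_hahnPoly_pos ha hb i) n hn
  split_ifs with h
  · subst h
    simp only [orthonormalPoly_hahnMeasure_eval_mul_eval ha hb hn, ← mul_div_assoc]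
    rw [← Finset.sum_div, ← polyInner_hahnMeasure ha hb]
    exact div_self (polyInner_hahnPoly_pos ha hb m).ne'
  · rw [← polyInner_hahnMeasure ha hb, hE m hm, hE n hn, polyInner_C_mul_left,
      polyInner_C_mul_right, polyInner_hahnPoly_of_ne ha hb hm hn h, mul_zero, mul_zero]

theorem sqrt_hahnWeight_mul (ha : -1 < a) (hb : -1 < b) (x y : ℕ) :
    √(hahnWeight a b M x * hahnWeight a b M y) = √(hahnWeight a b M x) * √(hahnWeight a b M y) :=
  Real.sqrt_mul (hahnWeight_nonneg ha hb x) _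

/-- The Hahn ensembles exist. -/
theorem isDeterminantal_hahnEnsemble (ha : -1 < a) (hb : -1 < b) {N : ℕ} (hN : N ≤ M) :
    IsDeterminantal (hahnKernel N a b M) (hahnEnsemble N a b M) := by
  refine IsDeterminantal.determinantalMeasure ?_
  refine exists_isDeterminantal_of_idempotent (Finset.range (M + 1)) _ ?_ ?_ ?_
  · intro x y
    simp only [hahnKernel, mul_comm]
  · intro x y hx
    have : ¬ x ≤ M := fun h => hx (Finset.mem_range.2 (Nat.lt_succ_of_le h))
    simp [hahnKernel, hahnWeight, this]
  · intro x _ z _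
    set p := orthonormalPoly (hahnMeasure a b M)
    set W := hahnWeight a b M
    have hW : ∀ y, √(W y) * √(W y) = W y := fun y => Real.mul_self_sqrt (hahnWeight_nonneg ha hb y)
    calc ∑ y ∈ Finset.range (M + 1), hahnKernel N a b M x y * hahnKernel N a b M y z
        = ∑ y ∈ Finset.range (M + 1), ∑ m ∈ Finset.range N, ∑ n ∈ Finset.range N,
            √(W x) * √(W z) * ((p m).eval (x : ℝ) * (p n).eval (z : ℝ)) *
            (W y * ((p m).eval (y : ℝ) * (p n).eval (y : ℝ))) := by
          refine Finset.sum_congr rfl fun y _ => ?_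
          simp only [hahnKernel, sqrt_hahnWeight_mul ha hb]
          rw [mul_mul_mul_comm, Finset.sum_mul_sum, Finset.mul_sum]
          refine Finset.sum_congr rfl fun m _ => ?_
          rw [Finset.mul_sum]
          refine Finset.sum_congr rfl fun n _ => ?_
          linear_combination √(W x) * √(W z) * (p m).eval (x : ℝ) * (p n).eval (z : ℝ) *
            (p m).eval (y : ℝ) * (p n).eval (y : ℝ) * hW y
      _ = ∑ m ∈ Finset.range N, ∑ n ∈ Finset.range N,
            √(W x) * √(W z) * ((p m).eval (x : ℝ) * (p n).eval (z : ℝ)) *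
              (if m = n then 1 else 0) := by
          rw [Finset.sum_comm]
          refine Finset.sum_congr rfl fun m hm => ?_
          rw [Finset.sum_comm]
          refine Finset.sum_congr rfl fun n hn => ?_
          have hm := Finset.mem_range.1 hm
          have hn := Finset.mem_range.1 hn
          rw [← Finset.mul_sum, orthonormalPoly_hahnMeasure_orthonormal ha hb (by omega) (by omega)]
      _ = hahnKernel N a b M x z := by
          simp only [hahnKernel, sqrt_hahnWeight_mul ha hb]
          rw [Finset.mul_sum]
          refine Finset.sum_congr rfl fun m hm => ?_
          rw [Finset.sum_eq_single_of_mem m hm (fun n _ hn => by rw [if_neg hn.symm, mul_zero])]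
          simp [W, p]

/-! ### The dual orthogonality relation -/

noncomputable section

/-- The dual Hahn weights. -/
def dualHahnWeight (a b : ℝ) (M n : ℕ) : ℝ :=
  hahnWeight a b M 0 / polyInner (hahnMeasure a b M) (hahnPoly a b M n) (hahnPoly a b M n)

end

theorem dualHahnWeight_pos (ha : -1 < a) (hb : -1 < b) (n : ℕ) : 0 < dualHahnWeight a b M n :=
  div_pos (hahnWeight_pos ha hb (Nat.zero_le M)) (polyInner_hahnPoly_pos ha hb n)

theorem hahnKernel_eq (ha : -1 < a) (hb : -1 < b) {N : ℕ} (hN : N ≤ M) (x y : ℕ) :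
    hahnKernel N a b M x y =
      √(hahnWeight a b M x / hahnWeight a b M 0) * √(hahnWeight a b M y / hahnWeight a b M 0) *
      ∑ n ∈ Finset.range N, dualHahnWeight a b M n *
        ((hahnPoly a b M n).eval (x : ℝ) * (hahnPoly a b M n).eval (y : ℝ)) := by
  have h0 := hahnWeight_pos (a := a) (b := b) ha hb (Nat.zero_le M)
  rw [hahnKernel, sqrt_hahnWeight_mul ha hb, Real.sqrt_div (hahnWeight_nonneg ha hb x),
    Real.sqrt_div (hahnWeight_nonneg ha hb y), Finset.mul_sum, Finset.mul_sum]
  refine Finset.sum_congr rfl fun n hn => ?_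
  have hn := Finset.mem_range.1 hn
  rw [orthonormalPoly_hahnMeasure_eval_mul_eval ha hb (by omega), dualHahnWeight]
  have h1 : √(hahnWeight a b M 0) * √(hahnWeight a b M 0) = hahnWeight a b M 0 :=
    Real.mul_self_sqrt h0.le
  have h2 : √(hahnWeight a b M 0) ≠ 0 := (Real.sqrt_pos.2 h0).ne'
  have h3 := (polyInner_hahnPoly_pos (M := M) ha hb n).ne'
  nth_rewrite 3 [← h1]
  field_simp

theorem sum_dualHahnWeight_mul (ha : -1 < a) (hb : -1 < b) {x y : ℕ} (hx : x ≤ M) (hy : y ≤ M) :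
    ∑ n ∈ Finset.range (M + 1), dualHahnWeight a b M n *
        ((hahnPoly a b M n).eval (x : ℝ) * (hahnPoly a b M n).eval (y : ℝ)) =
      if x = y then hahnWeight a b M 0 / hahnWeight a b M x else 0 := by
  set p := orthonormalPoly (hahnMeasure a b M)
  set W := hahnWeight a b M
  have hWp : ∀ x ≤ M, 0 < W x := fun x hx => hahnWeight_pos ha hb hx
  have hW : ∀ y, √(W y) * √(W y) = W y := fun y => Real.mul_self_sqrt (hahnWeight_nonneg ha hb y)
  let U : Matrix (Fin (M + 1)) (Fin (M + 1)) ℝ := Matrix.of fun n x => √(W x) * (p n).eval (x : ℝ)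
  have hU : U * U.transpose = 1 := by
    ext m n
    rw [Matrix.mul_apply, Matrix.one_apply]
    have h := orthonormalPoly_hahnMeasure_orthonormal ha hb (Nat.le_of_lt_succ m.2)
      (Nat.le_of_lt_succ n.2)
    rw [← Fin.sum_univ_eq_sum_range (fun x => W x * ((p m).eval (x : ℝ) * (p n).eval (x : ℝ)))] at h
    simp only [Fin.ext_iff, ← h]
    refine Finset.sum_congr rfl fun x _ => ?_
    simp only [U, Matrix.of_apply, Matrix.transpose_apply]
    linear_combination (p m).eval (x : ℝ) * (p n).eval (x : ℝ) * hW x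
  have hU1 : U.transpose * U = 1 := mul_eq_one_comm.1 hU
  have hU' := congrFun (congrFun hU1 ⟨x, Nat.lt_succ_of_le hx⟩)
    ⟨y, Nat.lt_succ_of_le hy⟩
  rw [Matrix.mul_apply, Matrix.one_apply] at hU'
  simp only [U, Matrix.of_apply, Matrix.transpose_apply, Fin.mk.injEq] at hU'
  rw [Fin.sum_univ_eq_sum_range
    (fun n => √(W x) * (p n).eval (x : ℝ) * (√(W y) * (p n).eval (y : ℝ)))] at hU'
  have hsx : √(W x) ≠ 0 := (Real.sqrt_pos.2 (hWp x hx)).ne'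
  have hsy : √(W y) ≠ 0 := (Real.sqrt_pos.2 (hWp y hy)).ne'
  have h1 : √(W x) * √(W y) * ∑ n ∈ Finset.range (M + 1), dualHahnWeight a b M n *
        ((hahnPoly a b M n).eval (x : ℝ) * (hahnPoly a b M n).eval (y : ℝ)) =
      W 0 * if x = y then 1 else 0 := by
    rw [← hU', Finset.mul_sum, Finset.mul_sum]
    refine Finset.sum_congr rfl fun n hn => ?_
    have h2 := orthonormalPoly_hahnMeasure_eval_mul_eval ha hb
      (Nat.le_of_lt_succ (Finset.mem_range.1 hn)) (x : ℝ) (y : ℝ)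
    rw [dualHahnWeight]
    linear_combination -(W 0 * √(W x) * √(W y)) * h2
  split_ifs at h1 ⊢ with h
  · subst h
    rw [hW, mul_one] at h1
    rw [eq_div_iff (hWp x hx).ne', ← h1, mul_comm]
  · rw [mul_zero] at h1
    exact (mul_eq_zero.1 h1).resolve_left (mul_ne_zero hsx hsy)

end HahnEnsemble

/-! ### Convergence of the moments of the dual Hahn weights -/

section Moments

noncomputable section

/-- The polynomials `∏ (t - λ_j / M) / (1 - j / M)`, where `j < k` and `λ_j = j(j+a+b+1)`. -/
def dualHahnFactor (a b : ℝ) (M k : ℕ) (t : ℝ) : ℝ :=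
  ∏ j ∈ Finset.range k, (t - hahnEigenvalue a b j / M) / (1 - j / M)

/-- The sum over `n < A` of the values of `f` at the scaled points `λ_n / M` of the dual lattice,
with the dual Hahn weights. -/
def dualHahnSum (a b : ℝ) (M A : ℕ) (f : ℝ → ℝ) : ℝ :=
  ∑ n ∈ Finset.range A, dualHahnWeight a b M n * f (hahnEigenvalue a b n / M)

/-- The coefficients of the Laguerre polynomials normalized by the value `1` at `0`. -/
def laguerreCoeff (a : ℝ) (x k : ℕ) : ℝ :=
  x.choose k * ((-1) ^ k / (ascPochhammer ℝ k).eval (a + 1))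

end

variable {a b : ℝ} {M A : ℕ}

theorem hahnCoeff_eq (ha : -1 < a) {n k : ℕ} (hk : k ≤ M) :
    hahnCoeff a b M n k = (-1) ^ k / (ascPochhammer ℝ k).eval (a + 1) *
      dualHahnFactor a b M k (hahnEigenvalue a b n / M) := by
  induction k with
  | zero => simp [hahnCoeff, dualHahnFactor]
  | succ k ih =>
    have h1 := hahnCoeff_succ (b := b) (n := n) ha (show k < M by omega)
    have hkM : (k : ℝ) < M := by exact_mod_cast hk
    have hk0 : (0 : ℝ) ≤ k := k.cast_nonneg
    have h2 : (a + k + 1) * (M - k) ≠ 0 := mul_ne_zero (by linarith) (by linarith)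
    have h3 := (ascPochhammer_eval_add_one_pos ha k).ne'
    have h4 : (M : ℝ) ≠ 0 := by linarith
    have h5 : (M : ℝ) - k ≠ 0 := by linarith
    have h6 : a + 1 + k ≠ 0 := by linarith
    have h7 : a + k + 1 ≠ 0 := by linarith
    rw [ih (by omega), ← eq_div_iff h2] at h1
    rw [h1, ascPochhammer_succ_eval]
    simp only [dualHahnFactor]
    rw [Finset.prod_range_succ]
    have h8 : (1 : ℝ) - k / M ≠ 0 := by
      rw [one_sub_div h4]; exact div_ne_zero h5 h4
    have h9 : (1 : ℝ) - k / M = (M - k) / M := one_sub_div h4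
    rw [h9]
    set P := ∏ j ∈ Finset.range k, (hahnEigenvalue a b n / M - hahnEigenvalue a b j / M) / (1 - j / M)
    rw [pow_succ]
    field_simp
    ring

theorem hahnCoeff_eq_zero {n k : ℕ} (hk : n < k) : hahnCoeff a b M n k = 0 := by
  rw [hahnCoeff, Finset.prod_eq_zero (Finset.mem_range.2 hk) (sub_self _), zero_div]

theorem hahnPoly_eval_eq_dual (ha : -1 < a) {n x : ℕ} (hx : x ≤ M) :
    (hahnPoly a b M n).eval (x : ℝ) = ∑ k ∈ Finset.range (x + 1),
      laguerreCoeff a x k * dualHahnFactor a b M k (hahnEigenvalue a b n / M) := by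
  rw [hahnPoly_eval_natCast]
  have h1 : ∀ m, ∑ k ∈ Finset.range (n + 1 + m), hahnCoeff a b M n k * (x.choose k : ℝ) =
      ∑ k ∈ Finset.range (n + 1), hahnCoeff a b M n k * (x.choose k : ℝ) := by
    intro m
    rw [Finset.sum_range_add, Finset.sum_eq_zero (s := Finset.range m), add_zero]
    intro i _
    rw [hahnCoeff_eq_zero (by omega), zero_mul]
  have h2 : ∀ m, ∑ k ∈ Finset.range (x + 1 + m), hahnCoeff a b M n k * (x.choose k : ℝ) =
      ∑ k ∈ Finset.range (x + 1), hahnCoeff a b M n k * (x.choose k : ℝ) := by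
    intro m
    rw [Finset.sum_range_add, Finset.sum_eq_zero (s := Finset.range m), add_zero]
    intro i _
    rw [Nat.choose_eq_zero_of_lt (by omega), Nat.cast_zero, mul_zero]
  rw [← h1 (x + 1), add_comm, h2]
  refine Finset.sum_congr rfl fun k hk => ?_
  have := Finset.mem_range.1 hk
  rw [hahnCoeff_eq ha (by omega), laguerreCoeff]
  ring

theorem dualHahnSum_add (f g : ℝ → ℝ) : dualHahnSum a b M A (fun t => f t + g t) =
    dualHahnSum a b M A f + dualHahnSum a b M A g := by
  simp only [dualHahnSum, mul_add, Finset.sum_add_distrib]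

theorem dualHahnSum_const_mul (c : ℝ) (f : ℝ → ℝ) : dualHahnSum a b M A (fun t => c * f t) =
    c * dualHahnSum a b M A f := by
  simp only [dualHahnSum, Finset.mul_sum, mul_left_comm]

theorem dualHahnSum_sum {ι : Type*} (s : Finset ι) (f : ι → ℝ → ℝ) :
    dualHahnSum a b M A (fun t => ∑ i ∈ s, f i t) = ∑ i ∈ s, dualHahnSum a b M A (f i) := by
  simp only [dualHahnSum, Finset.mul_sum]
  exact Finset.sum_comm

theorem mul_dualHahnFactor {k : ℕ} (hk : k < M) (t : ℝ) :
    t * dualHahnFactor a b M k t = (1 - k / M) * dualHahnFactor a b M (k + 1) t +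
      hahnEigenvalue a b k / M * dualHahnFactor a b M k t := by
  have hkM : (k : ℝ) < M := by exact_mod_cast hk
  have hk0 : (0 : ℝ) ≤ k := k.cast_nonneg
  have h4 : (M : ℝ) ≠ 0 := by linarith
  have h8 : (1 : ℝ) - k / M ≠ 0 := by
    rw [one_sub_div h4]; exact div_ne_zero (by linarith) h4
  rw [dualHahnFactor, dualHahnFactor, Finset.prod_range_succ]
  set P := ∏ j ∈ Finset.range k, (t - hahnEigenvalue a b j / M) / (1 - (j : ℝ) / M)
  set D := (1 : ℝ) - k / M
  field_simp
  ring

theorem dualHahnSum_pow_succ {k : ℕ} (hk : k < M) (i : ℕ) (f : ℝ → ℝ) :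
    dualHahnSum a b M A (fun t => t ^ (i + 1) * (dualHahnFactor a b M k t * f t)) =
      (1 - k / M) * dualHahnSum a b M A (fun t => t ^ i * (dualHahnFactor a b M (k + 1) t * f t)) +
      hahnEigenvalue a b k / M *
        dualHahnSum a b M A (fun t => t ^ i * (dualHahnFactor a b M k t * f t)) := by
  rw [← dualHahnSum_const_mul, ← dualHahnSum_const_mul, ← dualHahnSum_add]
  congr 1
  ext t
  have := mul_dualHahnFactor (a := a) (b := b) hk t
  linear_combination t ^ i * f t * this

theorem sum_choose_mul_neg_one_pow (x : ℕ) :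
    ∑ k ∈ Finset.range (x + 1), (x.choose k : ℝ) * (-1) ^ k = if x = 0 then 1 else 0 := by
  have h := Int.alternating_sum_range_choose (n := x)
  have h' := congrArg (Int.cast : ℤ → ℝ) h
  push_cast at h'
  simpa [mul_comm] using h'

theorem dualHahnSum_hahnPoly (ha : -1 < a) {x y : ℕ} (hx : x ≤ M) (hy : y ≤ M) :
    ∑ n ∈ Finset.range A, dualHahnWeight a b M n *
        ((hahnPoly a b M n).eval (x : ℝ) * (hahnPoly a b M n).eval (y : ℝ)) =
      ∑ k ∈ Finset.range (x + 1), ∑ l ∈ Finset.range (y + 1),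
        laguerreCoeff a x k * laguerreCoeff a y l *
          dualHahnSum a b M A (fun t => dualHahnFactor a b M k t * dualHahnFactor a b M l t) := by
  have h1 : ∑ n ∈ Finset.range A, dualHahnWeight a b M n *
        ((hahnPoly a b M n).eval (x : ℝ) * (hahnPoly a b M n).eval (y : ℝ)) =
      dualHahnSum a b M A (fun t => ∑ k ∈ Finset.range (x + 1), ∑ l ∈ Finset.range (y + 1),
        laguerreCoeff a x k * laguerreCoeff a y l *
          (dualHahnFactor a b M k t * dualHahnFactor a b M l t)) := by
    rw [dualHahnSum]
    refine Finset.sum_congr rfl fun n _ => ?_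
    rw [hahnPoly_eval_eq_dual ha hx, hahnPoly_eval_eq_dual ha hy, Finset.sum_mul_sum]
    congr 1
    refine Finset.sum_congr rfl fun k _ => Finset.sum_congr rfl fun l _ => ?_
    ring
  rw [h1, dualHahnSum_sum]
  refine Finset.sum_congr rfl fun k _ => ?_
  rw [dualHahnSum_sum]
  refine Finset.sum_congr rfl fun l _ => ?_
  rw [dualHahnSum_const_mul]

/-- The factorial moments of the dual Hahn weights. -/
theorem dualHahnSum_dualHahnFactor (ha : -1 < a) (hb : -1 < b) {k : ℕ} (hk : k ≤ M) :
    dualHahnSum a b M (M + 1) (dualHahnFactor a b M k) = (ascPochhammer ℝ k).eval (a + 1) := by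
  induction k using Nat.strong_induction_on with
  | _ k ih =>
    have h1 := sum_dualHahnWeight_mul ha hb hk (Nat.zero_le M)
    rw [dualHahnSum_hahnPoly ha hk (Nat.zero_le M)] at h1
    have h2 : (if k = 0 then hahnWeight a b M 0 / hahnWeight a b M k else 0)
        = if k = 0 then (1 : ℝ) else 0 := by
      split_ifs with h
      · rw [h, div_self (hahnWeight_pos ha hb (Nat.zero_le M)).ne']
      · rfl
    rw [h2, ← sum_choose_mul_neg_one_pow, Finset.sum_range_succ,
      Finset.sum_range_succ (fun j => (k.choose j : ℝ) * (-1) ^ j)] at h1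
    have h3 : ∀ j, ∑ l ∈ Finset.range (0 + 1), laguerreCoeff a k j * laguerreCoeff a 0 l *
        dualHahnSum a b M (M + 1) (fun t => dualHahnFactor a b M j t * dualHahnFactor a b M l t) =
        laguerreCoeff a k j * dualHahnSum a b M (M + 1) (dualHahnFactor a b M j) := by
      intro j
      have h0 : ∀ t, dualHahnFactor a b M 0 t = 1 := fun t => by simp [dualHahnFactor]
      simp [laguerreCoeff, h0]
    simp only [h3] at h1
    have h4 : ∑ j ∈ Finset.range k,
        laguerreCoeff a k j * dualHahnSum a b M (M + 1) (dualHahnFactor a b M j) =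
        ∑ j ∈ Finset.range k, (k.choose j : ℝ) * (-1) ^ j := by
      refine Finset.sum_congr rfl fun j hj => ?_
      have hj := Finset.mem_range.1 hj
      have h5 := (ascPochhammer_eval_add_one_pos ha j).ne'
      rw [ih j hj (by omega), laguerreCoeff]
      field_simp
    rw [h4] at h1
    have h5 := (ascPochhammer_eval_add_one_pos ha k).ne'
    have h6 := add_left_cancel h1
    simp only [laguerreCoeff, Nat.choose_self, Nat.cast_one, one_mul] at h6
    have h7 : ((-1 : ℝ) ^ k) ≠ 0 := by simp
    field_simp at h6
    exact h6

variable {M : ℕ → ℕ} {A : ℕ → ℕ}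

theorem tendsto_one_sub_div (hM : Tendsto (fun N => (M N : ℝ)) atTop atTop) (k : ℕ) :
    Tendsto (fun N => 1 - (k : ℝ) / M N) atTop (𝓝 1) := by
  simpa using (tendsto_const_nhds (x := (1 : ℝ))).sub (hM.const_div_atTop (k : ℝ))

theorem eventually_lt_of_tendsto (hM : Tendsto (fun N => (M N : ℝ)) atTop atTop) (k : ℕ) :
    ∀ᶠ N in atTop, k < M N :=
  (hM.eventually_gt_atTop (k : ℝ)).mono fun N h => by exact_mod_cast h

/-- The moments of the dual Hahn weights converge to those of the gamma distribution. -/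
theorem tendsto_dualHahnSum_pow (ha : -1 < a) (hb : -1 < b)
    (hM : Tendsto (fun N => (M N : ℝ)) atTop atTop) (i : ℕ) :
    Tendsto (fun N => dualHahnSum a b (M N) (M N + 1) (fun t => t ^ i)) atTop
      (𝓝 ((ascPochhammer ℝ i).eval (a + 1))) := by
  have key : ∀ i k, Tendsto (fun N => dualHahnSum a b (M N) (M N + 1)
      (fun t => t ^ i * (dualHahnFactor a b (M N) k t * 1))) atTop
      (𝓝 ((ascPochhammer ℝ (i + k)).eval (a + 1))) := by
    intro i
    induction i with
    | zero =>
      intro k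
      refine tendsto_const_nhds.congr' ?_
      filter_upwards [eventually_lt_of_tendsto hM k] with N hN
      simp only [pow_zero, one_mul, mul_one, zero_add]
      exact (dualHahnSum_dualHahnFactor ha hb hN.le).symm
    | succ i ih =>
      intro k
      have h := ((tendsto_one_sub_div hM k).mul (ih (k + 1))).add
        ((hM.const_div_atTop (hahnEigenvalue a b k)).mul (ih k))
      rw [one_mul, zero_mul, add_zero] at h
      rw [add_right_comm, add_assoc]
      refine h.congr' ?_
      filter_upwards [eventually_lt_of_tendsto hM k] with N hN
      exact (dualHahnSum_pow_succ hN i _).symm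
  simpa [dualHahnFactor] using key i 0

theorem tendsto_dualHahnSum_dualHahnFactor_mul
    (hM : Tendsto (fun N => (M N : ℝ)) atTop atTop) {c : ℕ → ℝ} {f : ℕ → ℝ → ℝ}
    (h : ∀ i, Tendsto (fun N => dualHahnSum a b (M N) (A N) (fun t => t ^ i * f N t)) atTop
      (𝓝 (c i))) (k i : ℕ) :
    Tendsto (fun N => dualHahnSum a b (M N) (A N)
      (fun t => t ^ i * (dualHahnFactor a b (M N) k t * f N t))) atTop (𝓝 (c (i + k))) := by
  induction k generalizing i with
  | zero => simpa [dualHahnFactor] using h i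
  | succ k ih =>
    have h1 := ((ih (i + 1)).sub ((hM.const_div_atTop (hahnEigenvalue a b k)).mul (ih i))).div
      (tendsto_one_sub_div hM k) one_ne_zero
    rw [zero_mul, sub_zero, div_one, add_right_comm, add_assoc] at h1
    refine h1.congr' ?_
    filter_upwards [eventually_lt_of_tendsto hM k] with N hN
    have hkM : (k : ℝ) < M N := by exact_mod_cast hN
    have hk0 : (0 : ℝ) ≤ k := k.cast_nonneg
    have h4 : (M N : ℝ) ≠ 0 := by linarith
    have h8 : (1 : ℝ) - k / M N ≠ 0 := by
      rw [one_sub_div h4]; exact div_ne_zero (by linarith) h4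
    rw [Pi.div_apply, dualHahnSum_pow_succ hN i, div_eq_iff h8]
    ring

theorem tendsto_dualHahnSum_hahnPoly (ha : -1 < a)
    (hM : Tendsto (fun N => (M N : ℝ)) atTop atTop) {c : ℕ → ℝ}
    (h : ∀ i, Tendsto (fun N => dualHahnSum a b (M N) (A N) (fun t => t ^ i)) atTop
      (𝓝 (c i))) (x y : ℕ) :
    Tendsto (fun N => ∑ n ∈ Finset.range (A N), dualHahnWeight a b (M N) n *
        ((hahnPoly a b (M N) n).eval (x : ℝ) * (hahnPoly a b (M N) n).eval (y : ℝ))) atTop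
      (𝓝 (∑ k ∈ Finset.range (x + 1), ∑ l ∈ Finset.range (y + 1),
        laguerreCoeff a x k * laguerreCoeff a y l * c (k + l))) := by
  have h1 : ∀ k l, Tendsto (fun N => dualHahnSum a b (M N) (A N)
      (fun t => dualHahnFactor a b (M N) k t * dualHahnFactor a b (M N) l t)) atTop
      (𝓝 (c (k + l))) := by
    intro k l
    have h2 := fun i => tendsto_dualHahnSum_dualHahnFactor_mul (a := a) (b := b) (A := A)
      (f := fun _ _ => 1) hM (by simpa using h) l i
    have h3 := tendsto_dualHahnSum_dualHahnFactor_mul (a := a) (b := b) (A := A)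
      (f := fun N t => dualHahnFactor a b (M N) l t * 1) hM (c := fun i => c (i + l)) h2 k 0
    simpa using h3
  have h2 := tendsto_finsetSum (Finset.range (x + 1)) fun k _ =>
    tendsto_finsetSum (Finset.range (y + 1)) fun l _ =>
      (h1 k l).const_mul (laguerreCoeff a x k * laguerreCoeff a y l)
  refine h2.congr' ?_
  filter_upwards [eventually_lt_of_tendsto hM x, eventually_lt_of_tendsto hM y] with N hx hy
  exact (dualHahnSum_hahnPoly ha hx.le hy.le).symm

theorem tendsto_hahnWeight_div (ha : -1 < a) (hb : -1 < b)
    (hM : Tendsto (fun N => (M N : ℝ)) atTop atTop) (x : ℕ) :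
    Tendsto (fun N => hahnWeight a b (M N) x / hahnWeight a b (M N) 0) atTop
      (𝓝 ((ascPochhammer ℝ x).eval (a + 1) / x.factorial)) := by
  induction x with
  | zero =>
    refine tendsto_const_nhds.congr fun N => ?_
    rw [div_self (hahnWeight_pos ha hb (Nat.zero_le _)).ne']
    simp
  | succ x ih =>
    have h1 : Tendsto (fun N => (x + a + 1) / (x + 1) *
        ((1 - (x : ℝ) / M N) / (1 + (b - x) / M N))) atTop
        (𝓝 ((x + a + 1) / (x + 1) * (1 / (1 + 0)))) := by
      refine Tendsto.const_mul _ (Tendsto.div (tendsto_one_sub_div hM x) ?_ (by norm_num))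
      exact tendsto_const_nhds.add (hM.const_div_atTop (b - x))
    have h2 := ih.mul h1
    have h3 : (ascPochhammer ℝ x).eval (a + 1) / x.factorial *
        ((x + a + 1) / (x + 1) * (1 / (1 + 0))) =
        (ascPochhammer ℝ (x + 1)).eval (a + 1) / (x + 1).factorial := by
      rw [ascPochhammer_succ_eval, Nat.factorial_succ]
      push_cast
      field_simp
      ring
    rw [h3] at h2
    refine h2.congr' ?_
    filter_upwards [eventually_lt_of_tendsto hM x] with N hN
    have h4 := hahnWeight_succ ha hb hN
    have hxM : (x : ℝ) + 1 ≤ M N := by exact_mod_cast hN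
    have hx0 : (0 : ℝ) ≤ x := x.cast_nonneg
    have h5 : (M N : ℝ) ≠ 0 := by linarith
    have h6 : b + M N - x ≠ 0 := by linarith
    have h7 : (1 : ℝ) + (b - x) / M N = (b + M N - x) / M N := by field_simp; ring
    have h8 : (1 : ℝ) - x / M N = (M N - x) / M N := one_sub_div h5
    have h9 := (hahnWeight_pos (M := M N) ha hb (Nat.zero_le _)).ne'
    have h10 : (x : ℝ) + 1 ≠ 0 := by linarith
    rw [h7, h8]
    field_simp
    linear_combination -h4
end Moments

/-! ### The method of moments on the half-line -/

section MethodOfMoments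

theorem norm_exp_mul_I_sub_sum_le (s : ℝ) (J : ℕ) {t : ℝ} (ht : 0 ≤ t) :
    ‖Complex.exp (s * t * Complex.I) -
      ∑ j ∈ Finset.range J, (s * Complex.I) ^ j / j.factorial * (t : ℂ) ^ j‖ ≤
        |s| ^ J / J.factorial * t ^ J := by
  induction J generalizing t with
  | zero =>
    have h := Complex.norm_exp_ofReal_mul_I (s * t)
    push_cast at h
    simp [h]
  | succ J ih =>
    have hd : ∀ x : ℝ, HasDerivAt (fun t : ℝ => Complex.exp (s * t * Complex.I) -
        ∑ j ∈ Finset.range (J + 1), (s * Complex.I) ^ j / j.factorial * (t : ℂ) ^ j)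
        ((s * Complex.I) * (Complex.exp (s * x * Complex.I) -
        ∑ j ∈ Finset.range J, (s * Complex.I) ^ j / j.factorial * (x : ℂ) ^ j)) x := by
      intro x
      have h1 : HasDerivAt (fun t : ℝ => Complex.exp (s * t * Complex.I))
          (Complex.exp (s * x * Complex.I) * (s * 1 * Complex.I)) x :=
        ((((hasDerivAt_id x).ofReal_comp).const_mul (s : ℂ)).mul_const Complex.I).cexp
      have h2 : ∀ j : ℕ, HasDerivAt (fun t : ℝ => (t : ℂ) ^ j) (j * (x : ℂ) ^ (j - 1)) x :=
        fun j => (hasDerivAt_pow j (x : ℂ)).comp_ofReal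
      have h3 := HasDerivAt.fun_sum (u := Finset.range (J + 1)) fun j _ =>
        (h2 j).const_mul ((s * Complex.I) ^ j / j.factorial)
      refine (h1.sub h3).congr_deriv (Eq.symm ?_)
      rw [Finset.sum_range_succ', mul_sub, Finset.mul_sum]
      simp only [Nat.cast_zero, zero_mul, mul_zero, add_zero, mul_one]
      congr 1
      · ring
      · refine Finset.sum_congr rfl fun j _ => ?_
        rw [Nat.factorial_succ, Nat.add_sub_cancel]
        have : (j.factorial : ℂ) ≠ 0 := by exact_mod_cast j.factorial_ne_zero
        have : (j : ℂ) + 1 ≠ 0 := by exact_mod_cast j.succ_ne_zero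
        push_cast
        field_simp
        ring
    refine image_norm_le_of_norm_deriv_right_le_deriv_boundary (a := 0) (b := t)
      (B' := fun x => |s| * (|s| ^ J / J.factorial * x ^ J))
      (B := fun x => |s| ^ (J + 1) / (J + 1).factorial * x ^ (J + 1))
      (fun x _ => (hd x).continuousAt.continuousWithinAt)
      (fun x _ => (hd x).hasDerivWithinAt) ?_ ?_ ?_ ⟨ht, le_rfl⟩
    · rw [Finset.sum_range_succ']
      simp
    · intro x
      have := (hasDerivAt_pow (J + 1) x).const_mul (|s| ^ (J + 1) / (J + 1).factorial)
      refine this.congr_deriv ?_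
      rw [Nat.factorial_succ, Nat.add_sub_cancel]
      push_cast
      field_simp
      ring
    · intro x hx
      rw [norm_mul]
      have : ‖(s : ℂ) * Complex.I‖ = |s| := by simp
      rw [this]
      exact mul_le_mul_of_nonneg_left (ih hx.1) (abs_nonneg s)

theorem tendsto_of_forall_approx {E : Type*} [NormedAddCommGroup E] {a : ℕ → E} {a₀ : E}
    {s : ℕ → ℕ → E} {s₀ : ℕ → E} {r : ℕ → ℕ → ℝ} {r₀ : ℕ → ℝ}
    (hs : ∀ J, Tendsto (fun N => s N J) atTop (𝓝 (s₀ J)))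
    (hr : ∀ J, Tendsto (fun N => r N J) atTop (𝓝 (r₀ J)))
    (h : ∀ N J, ‖a N - s N J‖ ≤ r N J) (h₀ : ∀ J, ‖a₀ - s₀ J‖ ≤ r₀ J)
    (hr₀ : Tendsto r₀ atTop (𝓝 0)) : Tendsto a atTop (𝓝 a₀) := by
  rw [tendsto_iff_norm_sub_tendsto_zero, Metric.tendsto_atTop']
  intro ε hε
  obtain ⟨J, hJ⟩ := (hr₀.eventually_lt_const (show 0 < ε / 3 by positivity)).exists
  have h1 := (hr J).eventually_lt_const hJ
  have h2 := (tendsto_iff_norm_sub_tendsto_zero.1 (hs J)).eventually_lt_const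
    (show 0 < ε / 3 by positivity)
  obtain ⟨n, hn⟩ := eventually_atTop.1 (h1.and h2)
  refine ⟨n, fun N hN => ?_⟩
  obtain ⟨h3, h4⟩ := hn N hN.le
  rw [Real.dist_0_eq_abs, abs_norm]
  have h5 : a N - a₀ = (a N - s N J) + (s N J - s₀ J) - (a₀ - s₀ J) := by abel
  rw [h5]
  have h6 := norm_sub_le ((a N - s N J) + (s N J - s₀ J)) (a₀ - s₀ J)
  have h7 := norm_add_le (a N - s N J) (s N J - s₀ J)
  have := h N J
  have := h₀ J
  linarith

theorem integrable_pow_mul_cexp {ρ : Measure ℝ} (hint : ∀ k : ℕ, Integrable (fun t => t ^ k) ρ)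
    (ξ : ℝ) (k : ℕ) :
    Integrable (fun t : ℝ => (t : ℂ) ^ k * Complex.exp (ξ * t * Complex.I)) ρ := by
  have h := (hint k).ofReal (𝕜 := ℂ)
  refine h.norm.mono' ?_ (ae_of_all _ fun t => ?_)
  · exact Continuous.aestronglyMeasurable (by fun_prop)
  · have h := Complex.norm_exp_ofReal_mul_I (ξ * t)
    push_cast at h
    simp [h]

theorem norm_integral_pow_mul_cexp_sub_le {ρ : Measure ℝ}
    (hint : ∀ k : ℕ, Integrable (fun t => t ^ k) ρ) (hpos : ∀ᵐ t ∂ρ, 0 ≤ t) (ξ s : ℝ) (k J : ℕ) :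
    ‖∫ t : ℝ, (t : ℂ) ^ k * Complex.exp ((ξ + s : ℝ) * t * Complex.I) ∂ρ -
      ∑ j ∈ Finset.range J, (s * Complex.I) ^ j / j.factorial *
        ∫ t : ℝ, (t : ℂ) ^ (k + j) * Complex.exp (ξ * t * Complex.I) ∂ρ‖ ≤
      |s| ^ J / J.factorial * ∫ t, t ^ (k + J) ∂ρ := by
  simp only [← integral_const_mul]
  rw [← integral_finsetSum _ fun j _ => (integrable_pow_mul_cexp hint ξ (k + j)).const_mul _,
    ← integral_sub (integrable_pow_mul_cexp hint _ _) (integrable_finsetSum _ fun j _ =>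
      (integrable_pow_mul_cexp hint ξ (k + j)).const_mul _)]
  refine norm_integral_le_of_norm_le ((hint (k + J)).const_mul _) ?_
  filter_upwards [hpos] with t ht
  have h1 : (t : ℂ) ^ k * Complex.exp ((ξ + s : ℝ) * t * Complex.I) -
      ∑ j ∈ Finset.range J, (s * Complex.I) ^ j / j.factorial *
        ((t : ℂ) ^ (k + j) * Complex.exp (ξ * t * Complex.I)) =
      (t : ℂ) ^ k * Complex.exp (ξ * t * Complex.I) * (Complex.exp (s * t * Complex.I) -
        ∑ j ∈ Finset.range J, (s * Complex.I) ^ j / j.factorial * (t : ℂ) ^ j) := by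
    rw [mul_sub, Finset.mul_sum]
    congr 1
    · rw [mul_assoc ((t : ℂ) ^ k), ← Complex.exp_add]
      congr 2
      push_cast
      ring
    · refine Finset.sum_congr rfl fun j _ => ?_
      rw [pow_add]
      ring
  have h2 := Complex.norm_exp_ofReal_mul_I (ξ * t)
  push_cast at h2
  rw [h1, norm_mul, norm_mul, h2, mul_one, norm_pow, Complex.norm_real, Real.norm_of_nonneg ht]
  calc _ ≤ t ^ k * (|s| ^ J / J.factorial * t ^ J) :=
        mul_le_mul_of_nonneg_left (norm_exp_mul_I_sub_sum_le s J ht) (by positivity)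
    _ = _ := by rw [pow_add]; ring

/-- The method of moments: on the half-line, convergence of all moments to those of a measure
with factorially bounded moments implies weak convergence. -/
theorem tendsto_of_tendsto_moments {ν : ℕ → ProbabilityMeasure ℝ} {μ : ProbabilityMeasure ℝ}
    (hν : ∀ N, ∀ k : ℕ, Integrable (fun t => t ^ k) (ν N : Measure ℝ))
    (hμ : ∀ k : ℕ, Integrable (fun t => t ^ k) (μ : Measure ℝ))
    (hν0 : ∀ N, ∀ᵐ t ∂(ν N : Measure ℝ), 0 ≤ t) (hμ0 : ∀ᵐ t ∂(μ : Measure ℝ), 0 ≤ t)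
    (hlim : ∀ k : ℕ, Tendsto (fun N => ∫ t, t ^ k ∂(ν N : Measure ℝ)) atTop
      (𝓝 (∫ t, t ^ k ∂(μ : Measure ℝ))))
    (hgrow : ∀ k : ℕ, Tendsto (fun J : ℕ => (1 / 2 : ℝ) ^ J / J.factorial *
      ∫ t, t ^ (k + J) ∂(μ : Measure ℝ)) atTop (𝓝 0)) :
    Tendsto ν atTop (𝓝 μ) := by
  have step : ∀ ξ s : ℝ, |s| ≤ 1 / 2 →
      (∀ k : ℕ, Tendsto (fun N => ∫ t : ℝ, (t : ℂ) ^ k * Complex.exp (ξ * t * Complex.I)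
        ∂(ν N : Measure ℝ)) atTop
        (𝓝 (∫ t : ℝ, (t : ℂ) ^ k * Complex.exp (ξ * t * Complex.I) ∂(μ : Measure ℝ)))) →
      ∀ k : ℕ, Tendsto (fun N => ∫ t : ℝ, (t : ℂ) ^ k *
        Complex.exp ((ξ + s : ℝ) * t * Complex.I) ∂(ν N : Measure ℝ)) atTop
        (𝓝 (∫ t : ℝ, (t : ℂ) ^ k *
          Complex.exp ((ξ + s : ℝ) * t * Complex.I) ∂(μ : Measure ℝ))) := by
    intro ξ s hs hξ k
    have hnn : ∀ ρ : Measure ℝ, (∀ᵐ t ∂ρ, 0 ≤ t) → ∀ m : ℕ, 0 ≤ ∫ t, t ^ m ∂ρ := fun ρ hρ m =>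
      integral_nonneg_of_ae (hρ.mono fun t ht => pow_nonneg ht m)
    refine tendsto_of_forall_approx (fun J => tendsto_finsetSum (Finset.range J) fun j _ =>
        (hξ (k + j)).const_mul ((s * Complex.I) ^ j / j.factorial))
      (fun J => (hlim (k + J)).const_mul ((1 / 2 : ℝ) ^ J / J.factorial)) ?_ ?_ (hgrow k)
    · intro N J
      refine (norm_integral_pow_mul_cexp_sub_le (hν N) (hν0 N) ξ s k J).trans ?_
      have := hnn _ (hν0 N) (k + J)
      gcongr
    · intro J
      refine (norm_integral_pow_mul_cexp_sub_le hμ hμ0 ξ s k J).trans ?_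
      have := hnn _ hμ0 (k + J)
      gcongr
  have all : ∀ n : ℕ, ∀ ξ : ℝ, |ξ| ≤ n / 2 → ∀ k : ℕ, Tendsto (fun N => ∫ t : ℝ, (t : ℂ) ^ k *
        Complex.exp (ξ * t * Complex.I) ∂(ν N : Measure ℝ)) atTop
        (𝓝 (∫ t : ℝ, (t : ℂ) ^ k * Complex.exp (ξ * t * Complex.I) ∂(μ : Measure ℝ))) := by
    intro n
    induction n with
    | zero =>
      intro ξ hξ k
      have hξ0 : ξ = 0 := by simpa using hξ
      subst hξ0
      have h : ∀ ρ : Measure ℝ, ∫ t : ℝ, (t : ℂ) ^ k * Complex.exp ((0 : ℝ) * t * Complex.I) ∂ρ =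
          ((∫ t, t ^ k ∂ρ : ℝ) : ℂ) := by
        intro ρ
        rw [← integral_complex_ofReal]
        simp
      simp only [h]
      exact (Complex.continuous_ofReal.tendsto _).comp (hlim k)
    | succ n ih =>
      intro ξ hξ
      have hn : (0 : ℝ) < n + 1 := by positivity
      have h1 : ξ = ξ * (n / (n + 1)) + ξ / (n + 1) := by field_simp
      have h2 : |ξ / (n + 1)| ≤ 1 / 2 := by
        rw [abs_div, abs_of_pos hn, div_le_iff₀ hn]
        push_cast at hξ
        linarith
      have h3 : |ξ * (n / (n + 1))| ≤ n / 2 := by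
        rw [abs_mul, abs_of_nonneg (show (0 : ℝ) ≤ n / (n + 1) by positivity)]
        calc |ξ| * (n / (n + 1)) ≤ ((n + 1 : ℕ) / 2) * (n / (n + 1)) := by gcongr
          _ = n / 2 := by push_cast; field_simp
      have h := step _ _ h2 (ih _ h3)
      rwa [← h1] at h
  rw [ProbabilityMeasure.tendsto_iff_tendsto_charFun]
  intro ξ
  obtain ⟨n, hn⟩ := exists_nat_ge (|ξ| * 2)
  have h := all n ξ (by linarith) 0
  simpa [charFun_apply_real] using h

theorem integral_Iio_le_integral_mul_cutoff {ρ : Measure ℝ} [IsFiniteMeasure ρ] {f g : ℝ → ℝ}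
    (hf : Measurable f) (hg : Continuous g) {s C : ℝ}
    (hle : ∀ t < s, f t ≤ g t) (hf0 : ∀ t, 0 ≤ f t) (hg0 : ∀ t, 0 ≤ g t) (hC : ∀ t, g t ≤ C) :
    ∫ t in Set.Iio s, f t ∂ρ ≤ ∫ t, g t ∂ρ := by
  have hgi : Integrable g ρ := by
    refine Integrable.of_bound hg.aestronglyMeasurable C (ae_of_all _ fun t => ?_)
    rw [Real.norm_of_nonneg (hg0 t)]
    exact hC t
  have hfi : IntegrableOn f (Set.Iio s) ρ := by
    refine Integrable.mono' hgi.integrableOn hf.aestronglyMeasurable ?_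
    filter_upwards [ae_restrict_mem measurableSet_Iio] with t ht
    rw [Real.norm_of_nonneg (hf0 t)]
    exact hle t ht
  calc ∫ t in Set.Iio s, f t ∂ρ ≤ ∫ t in Set.Iio s, g t ∂ρ :=
        setIntegral_mono_on hfi hgi.integrableOn measurableSet_Iio hle
    _ ≤ ∫ t, g t ∂ρ := setIntegral_le_integral hgi (ae_of_all _ hg0)

theorem integral_mul_cutoff_le_integral_Iio {ρ : Measure ℝ} [IsFiniteMeasure ρ] {f g : ℝ → ℝ}
    (hf : Measurable f) {s C : ℝ} (hle : ∀ t, g t ≤ f t) (hf0 : ∀ t, 0 ≤ f t)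
    (hgs : ∀ t, s ≤ t → g t = 0) (hg : Continuous g) (hg0 : ∀ t, 0 ≤ g t)
    (hC : ∀ t ≤ s, f t ≤ C) :
    ∫ t, g t ∂ρ ≤ ∫ t in Set.Iio s, f t ∂ρ := by
  have hfi : IntegrableOn f (Set.Iio s) ρ := by
    refine Integrable.mono' (integrable_const C) hf.aestronglyMeasurable ?_
    filter_upwards [ae_restrict_mem measurableSet_Iio] with t ht
    rw [Real.norm_of_nonneg (hf0 t)]
    exact hC t (le_of_lt ht)
  have hgi : IntegrableOn g (Set.Iio s) ρ := by
    refine Integrable.mono' hfi hg.aestronglyMeasurable (ae_of_all _ fun t => ?_)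
    rw [Real.norm_of_nonneg (hg0 t)]
    exact hle t
  rw [← setIntegral_eq_integral_of_forall_compl_eq_zero (s := Set.Iio s)
    (fun t ht => hgs t (not_lt.1 ht))]
  exact setIntegral_mono_on hgi hfi measurableSet_Iio fun t _ => hle t

theorem continuousAt_integral_Iio {μ : Measure ℝ} [NullSingletonClass μ] {f : ℝ → ℝ}
    (hf : Integrable f μ) (r : ℝ) : ContinuousAt (fun s => ∫ t in Set.Iio s, f t ∂μ) r := by
  simp only [ContinuousAt, ← integral_indicator (measurableSet_Iio (α := ℝ))]
  refine tendsto_integral_filter_of_dominated_convergence (fun t => ‖f t‖)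
    (Eventually.of_forall fun s => hf.aestronglyMeasurable.indicator measurableSet_Iio)
    (Eventually.of_forall fun s => ae_of_all _ fun t => norm_indicator_le_norm_self f t) hf.norm ?_
  have hr : ∀ᵐ t ∂μ, t ≠ r := by
    rw [ae_iff]
    simp
  filter_upwards [hr] with t ht
  refine tendsto_const_nhds.congr' ?_
  rcases lt_or_gt_of_ne ht with h | h
  · filter_upwards [lt_mem_nhds h] with s hs
    rw [Set.indicator_of_mem (show t ∈ Set.Iio r from h),
      Set.indicator_of_mem (show t ∈ Set.Iio s from hs)]
  · filter_upwards [gt_mem_nhds h] with s hs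
    rw [Set.indicator_of_notMem (show t ∉ Set.Iio r from not_lt.2 h.le),
      Set.indicator_of_notMem (show t ∉ Set.Iio s from not_lt.2 (le_of_lt hs))]

/-- Under weak convergence to a measure without atoms, truncated integrals converge, also for
converging truncation points. -/
theorem tendsto_integral_Iio {ν : ℕ → ProbabilityMeasure ℝ} {μ : ProbabilityMeasure ℝ}
    [NullSingletonClass (μ : Measure ℝ)] (h : Tendsto ν atTop (𝓝 μ)) {f : ℝ → ℝ} (hf : Continuous f)
    (hf0 : ∀ t, 0 ≤ f t) (hfb : ∀ s, ∃ C, ∀ t ≤ s, f t ≤ C) (hfi : Integrable f (μ : Measure ℝ))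
    {τ : ℕ → ℝ} {r : ℝ} (hτ : Tendsto τ atTop (𝓝 r)) :
    Tendsto (fun N => ∫ t in Set.Iio (τ N), f t ∂(ν N : Measure ℝ)) atTop
      (𝓝 (∫ t in Set.Iio r, f t ∂(μ : Measure ℝ))) := by
  have hmono : ∀ N, ∀ s s', s ≤ s' → ∫ t in Set.Iio s, f t ∂(ν N : Measure ℝ) ≤
      ∫ t in Set.Iio s', f t ∂(ν N : Measure ℝ) := by
    intro N s s' hs
    obtain ⟨C, hC⟩ := hfb s'
    refine setIntegral_mono_set ?_ (ae_of_all _ hf0) (Set.Iio_subset_Iio hs).eventuallyLE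
    refine Integrable.mono' (integrable_const C) hf.aestronglyMeasurable ?_
    filter_upwards [ae_restrict_mem measurableSet_Iio] with t ht
    rw [Real.norm_of_nonneg (hf0 t)]
    exact hC t (le_of_lt ht)
  have hcut : ∀ s s' : ℝ, s < s' → ∃ c : ℝ,
      Tendsto (fun N => ∫ t, f t * max 0 (min 1 ((s' - t) / (s' - s))) ∂(ν N : Measure ℝ))
        atTop (𝓝 c) ∧
      (∀ N, ∫ t in Set.Iio s, f t ∂(ν N : Measure ℝ) ≤
        ∫ t, f t * max 0 (min 1 ((s' - t) / (s' - s))) ∂(ν N : Measure ℝ)) ∧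
      (∀ N, ∫ t, f t * max 0 (min 1 ((s' - t) / (s' - s))) ∂(ν N : Measure ℝ) ≤
        ∫ t in Set.Iio s', f t ∂(ν N : Measure ℝ)) ∧
      ∫ t in Set.Iio s, f t ∂(μ : Measure ℝ) ≤ c ∧ c ≤ ∫ t in Set.Iio s', f t ∂(μ : Measure ℝ) := by
    intro s s' hs
    have hs' : 0 < s' - s := sub_pos.2 hs
    obtain ⟨C, hC⟩ := hfb s'
    set χ : ℝ → ℝ := fun t => max 0 (min 1 ((s' - t) / (s' - s))) with hχ
    have hχc : Continuous χ := by fun_prop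
    have hχ0 : ∀ t, 0 ≤ χ t := fun t => le_max_left _ _
    have hχ1 : ∀ t, χ t ≤ 1 := fun t => max_le zero_le_one (min_le_left _ _)
    have hχs : ∀ t < s, χ t = 1 := by
      intro t ht
      have : 1 ≤ (s' - t) / (s' - s) := (one_le_div hs').2 (by linarith)
      rw [hχ]
      simp [min_eq_left this]
    have hχs' : ∀ t, s' ≤ t → χ t = 0 := by
      intro t ht
      refine max_eq_left ((min_le_right _ _).trans ?_)
      exact div_nonpos_of_nonpos_of_nonneg (by linarith) hs'.le
    have hgc : Continuous fun t => f t * χ t := hf.mul hχc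
    have hg0 : ∀ t, 0 ≤ f t * χ t := fun t => mul_nonneg (hf0 t) (hχ0 t)
    have hgf : ∀ t, f t * χ t ≤ f t := fun t => mul_le_of_le_one_right (hf0 t) (hχ1 t)
    have hgs : ∀ t, s' ≤ t → f t * χ t = 0 := fun t ht => by rw [hχs' t ht, mul_zero]
    have hgC : ∀ t, f t * χ t ≤ max C 0 := by
      intro t
      rcases le_or_gt t s' with ht | ht
      · exact (hgf t).trans ((hC t ht).trans (le_max_left _ _))
      · rw [hgs t ht.le]; exact le_max_right _ _
    have hfg : ∀ t < s, f t ≤ f t * χ t := fun t ht => by rw [hχs t ht, mul_one]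
    refine ⟨∫ t, f t * χ t ∂(μ : Measure ℝ), ?_, ?_, ?_, ?_, ?_⟩
    · have hb := (ProbabilityMeasure.tendsto_iff_forall_integral_tendsto.1 h)
        (BoundedContinuousFunction.ofNormedAddCommGroup (fun t => f t * χ t) hgc (max C 0)
          fun t => by rw [Real.norm_of_nonneg (hg0 t)]; exact hgC t)
      exact hb
    · exact fun N => integral_Iio_le_integral_mul_cutoff hf.measurable hgc hfg hf0 hg0 hgC
    · exact fun N => integral_mul_cutoff_le_integral_Iio hf.measurable hgf hf0 hgs hgc hg0 hC
    · exact integral_Iio_le_integral_mul_cutoff hf.measurable hgc hfg hf0 hg0 hgC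
    · exact integral_mul_cutoff_le_integral_Iio hf.measurable hgf hf0 hgs hgc hg0 hC
  have hc := continuousAt_integral_Iio hfi r
  rw [Metric.tendsto_atTop']
  intro ε hε
  obtain ⟨δ, hδ, hδε⟩ := Metric.continuousAt_iff.1 hc ε hε
  obtain ⟨c₁, h1, h2, -, -, h3⟩ := hcut (r + δ / 3) (r + δ / 2) (by linarith)
  obtain ⟨c₂, h4, -, h5, h6, -⟩ := hcut (r - δ / 2) (r - δ / 3) (by linarith)
  have h7 := hδε (x := r + δ / 2) (by rw [Real.dist_eq, abs_lt]; constructor <;> linarith)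
  have h8 := hδε (x := r - δ / 2) (by rw [Real.dist_eq, abs_lt]; constructor <;> linarith)
  rw [Real.dist_eq, abs_lt] at h7 h8
  have e1 := h1.eventually_lt_const
    (show c₁ < (∫ t in Set.Iio r, f t ∂(μ : Measure ℝ)) + ε by linarith)
  have e2 := h4.eventually_const_lt
    (show (∫ t in Set.Iio r, f t ∂(μ : Measure ℝ)) - ε < c₂ by linarith)
  have e3 := hτ.eventually_lt_const (show r < r + δ / 3 by linarith)
  have e4 := hτ.eventually_const_lt (show r - δ / 3 < r by linarith)
  obtain ⟨n, hn⟩ := eventually_atTop.1 ((e1.and e2).and (e3.and e4))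
  refine ⟨n, fun N hN => ?_⟩
  obtain ⟨⟨g1, g2⟩, g3, g4⟩ := hn N hN.le
  have := hmono N _ _ g3.le
  have := hmono N _ _ g4.le
  have := h2 N
  have := h5 N
  rw [Real.dist_eq, abs_lt]
  constructor <;> linarith

end MethodOfMoments

/-! ### The Laguerre weight -/

section Laguerre

variable {a b : ℝ}

theorem Gamma_add_one_add_natCast (ha : -1 < a) (k : ℕ) :
    Real.Gamma (a + 1 + k) = Real.Gamma (a + 1) * (ascPochhammer ℝ k).eval (a + 1) := by
  induction k with
  | zero => simp
  | succ k ih =>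
    have hk : (0 : ℝ) ≤ k := k.cast_nonneg
    rw [ascPochhammer_succ_eval, Nat.cast_succ, ← add_assoc,
      Real.Gamma_add_one (by linarith), ih]
    ring

theorem measurable_laguerreDensity (β : ℝ) :
    Measurable fun t : ℝ => ENNReal.ofReal (t ^ (β - 1) * Real.exp (-t)) := by
  fun_prop

theorem laguerreDensity_smul_pow (a : ℝ) (k : ℕ) {t : ℝ} (ht : t ∈ Set.Ioi (0 : ℝ)) :
    (ENNReal.ofReal (t ^ (a + 1 - 1) * Real.exp (-t))).toReal • t ^ k =
      Real.exp (-t) * t ^ (a + 1 + k - 1) := by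
  have ht' : (0 : ℝ) < t := ht
  rw [ENNReal.toReal_ofReal (by positivity), smul_eq_mul,
    show a + 1 + k - 1 = (a + 1 - 1) + k by ring, Real.rpow_add_natCast ht'.ne']
  ring

theorem integrable_pow_laguerreMeasure (ha : -1 < a) (k : ℕ) :
    Integrable (fun t => t ^ k) (laguerreMeasure (a + 1)) := by
  have hk : (0 : ℝ) ≤ k := k.cast_nonneg
  rw [laguerreMeasure, integrable_withDensity_iff_integrable_smul'
    (measurable_laguerreDensity _) (ae_of_all _ fun _ => ENNReal.ofReal_lt_top)]
  refine (integrableOn_congr_fun (fun t ht => laguerreDensity_smul_pow a k ht)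
    measurableSet_Ioi).2 ?_
  exact Real.GammaIntegral_convergent (by linarith)

theorem integral_pow_laguerreMeasure (ha : -1 < a) (k : ℕ) :
    ∫ t, t ^ k ∂(laguerreMeasure (a + 1)) =
      Real.Gamma (a + 1) * (ascPochhammer ℝ k).eval (a + 1) := by
  have hk : (0 : ℝ) ≤ k := k.cast_nonneg
  rw [laguerreMeasure, integral_withDensity_eq_integral_toReal_smul
    (measurable_laguerreDensity _) (ae_of_all _ fun _ => ENNReal.ofReal_lt_top),
    setIntegral_congr_fun measurableSet_Ioi (fun t ht => laguerreDensity_smul_pow a k ht),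
    ← Real.Gamma_eq_integral (by linarith), Gamma_add_one_add_natCast ha]

theorem integrable_eval_laguerreMeasure (ha : -1 < a) (p : ℝ[X]) :
    Integrable (fun t => p.eval t) (laguerreMeasure (a + 1)) := by
  simp only [eval_eq_sum_range]
  exact integrable_finsetSum _ fun k _ => (integrable_pow_laguerreMeasure ha k).const_mul _

instance nullSingletonClass_laguerreMeasure (β : ℝ) : NullSingletonClass (laguerreMeasure β) := by
  rw [laguerreMeasure]
  infer_instance

theorem ae_pos_laguerreMeasure (β : ℝ) : ∀ᵐ t ∂(laguerreMeasure β), 0 < t :=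
  (withDensity_absolutelyContinuous _ _).ae_le (ae_restrict_mem measurableSet_Ioi)

theorem isProbabilityMeasure_smul_laguerreMeasure (ha : -1 < a) : IsProbabilityMeasure
    (ENNReal.ofReal (Real.Gamma (a + 1))⁻¹ • laguerreMeasure (a + 1)) := by
  have hG := Real.Gamma_pos_of_pos (show 0 < a + 1 by linarith)
  have h := integral_pow_laguerreMeasure ha 0
  have hi := integrable_pow_laguerreMeasure ha 0
  simp only [pow_zero, integral_const, smul_eq_mul, mul_one, ascPochhammer_zero, eval_one] at h hi
  have hfin : IsFiniteMeasure (laguerreMeasure (a + 1)) :=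
    (integrable_const_iff_isFiniteMeasure one_ne_zero).1 hi
  constructor
  rw [Measure.smul_apply, smul_eq_mul, ← ENNReal.ofReal_toReal (measure_ne_top _ Set.univ),
    ← ENNReal.ofReal_mul (inv_nonneg.2 hG.le)]
  rw [Measure.real] at h
  rw [h, inv_mul_cancel₀ hG.ne', ENNReal.ofReal_one]

noncomputable section

/-- The gamma distribution, as the normalized Laguerre weight. -/
def laguerreProbability (ha : -1 < a) : ProbabilityMeasure ℝ :=
  ⟨_, isProbabilityMeasure_smul_laguerreMeasure ha⟩

/-- The Laguerre polynomials, normalized by the value `1` at `0`. -/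
def laguerrePoly (a : ℝ) (x : ℕ) : ℝ[X] :=
  ∑ k ∈ Finset.range (x + 1), C (laguerreCoeff a x k) * X ^ k

end

theorem setIntegral_laguerreProbability (ha : -1 < a) (s : Set ℝ) (f : ℝ → ℝ) :
    ∫ t in s, f t ∂(laguerreProbability ha : Measure ℝ) =
      (Real.Gamma (a + 1))⁻¹ * ∫ t in s, f t ∂(laguerreMeasure (a + 1)) := by
  have hG := Real.Gamma_pos_of_pos (show 0 < a + 1 by linarith)
  change ∫ t in s, f t ∂(ENNReal.ofReal (Real.Gamma (a + 1))⁻¹ • laguerreMeasure (a + 1)) = _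
  rw [Measure.restrict_smul, integral_smul_measure, ENNReal.toReal_ofReal (inv_nonneg.2 hG.le),
    smul_eq_mul]

theorem integral_laguerreProbability (ha : -1 < a) (f : ℝ → ℝ) :
    ∫ t, f t ∂(laguerreProbability ha : Measure ℝ) =
      (Real.Gamma (a + 1))⁻¹ * ∫ t, f t ∂(laguerreMeasure (a + 1)) := by
  have h := setIntegral_laguerreProbability ha Set.univ f
  rwa [setIntegral_univ, setIntegral_univ] at h

theorem ae_pos_laguerreProbability (ha : -1 < a) :
    ∀ᵐ t ∂(laguerreProbability ha : Measure ℝ), 0 < t :=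
  Measure.ae_smul_measure (ae_pos_laguerreMeasure _) _

instance nullSingletonClass_laguerreProbability (ha : -1 < a) :
    NullSingletonClass (laguerreProbability ha : Measure ℝ) := by
  refine ⟨fun x => ?_⟩
  change (ENNReal.ofReal (Real.Gamma (a + 1))⁻¹ • laguerreMeasure (a + 1)) {x} = 0
  simp

theorem integrable_pow_laguerreProbability (ha : -1 < a) (k : ℕ) :
    Integrable (fun t => t ^ k) (laguerreProbability ha : Measure ℝ) :=
  (integrable_pow_laguerreMeasure ha k).smul_measure ENNReal.ofReal_ne_top

theorem integral_pow_laguerreProbability (ha : -1 < a) (k : ℕ) :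
    ∫ t, t ^ k ∂(laguerreProbability ha : Measure ℝ) = (ascPochhammer ℝ k).eval (a + 1) := by
  have hG := Real.Gamma_pos_of_pos (show 0 < a + 1 by linarith)
  rw [integral_laguerreProbability, integral_pow_laguerreMeasure ha,
    inv_mul_cancel_left₀ hG.ne']

theorem tendsto_half_pow_div_factorial_mul_ascPochhammer (ha : -1 < a) (k : ℕ) :
    Tendsto (fun J : ℕ => (1 / 2 : ℝ) ^ J / J.factorial * (ascPochhammer ℝ (k + J)).eval (a + 1))
      atTop (𝓝 0) := by
  have hpos : ∀ J : ℕ, 0 < (1 / 2 : ℝ) ^ J / J.factorial *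
      (ascPochhammer ℝ (k + J)).eval (a + 1) := fun J =>
    mul_pos (by positivity) (ascPochhammer_eval_add_one_pos ha _)
  refine (summable_of_ratio_test_tendsto_lt_one (l := 1 / 2) (by norm_num)
    (Eventually.of_forall fun J => (hpos J).ne') ?_).tendsto_atTop_zero
  have h1 : Tendsto (fun J : ℕ => (1 / 2 : ℝ) * (1 + (a + k) / (J + 1 : ℕ))) atTop
      (𝓝 (1 / 2 * (1 + 0))) := by
    refine Tendsto.const_mul _ (tendsto_const_nhds.add ?_)
    exact (tendsto_natCast_atTop_atTop.comp (tendsto_add_atTop_nat 1)).const_div_atTop (a + k)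
  rw [add_zero, mul_one] at h1
  refine h1.congr fun J => ?_
  rw [Real.norm_of_nonneg (hpos _).le, Real.norm_of_nonneg (hpos _).le, ← add_assoc,
    ascPochhammer_succ_eval, Nat.factorial_succ, pow_succ]
  have := (ascPochhammer_eval_add_one_pos ha (k + J)).ne'
  push_cast
  field_simp
  ring

theorem integral_laguerrePoly_mul {ρ : Measure ℝ} (hρ : ∀ k : ℕ, Integrable (fun t => t ^ k) ρ)
    (x y : ℕ) : ∫ t, (laguerrePoly a x).eval t * (laguerrePoly a y).eval t ∂ρ =
      ∑ k ∈ Finset.range (x + 1), ∑ l ∈ Finset.range (y + 1),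
        laguerreCoeff a x k * laguerreCoeff a y l * ∫ t, t ^ (k + l) ∂ρ := by
  have h1 : ∀ t, (laguerrePoly a x).eval t * (laguerrePoly a y).eval t =
      ∑ k ∈ Finset.range (x + 1), ∑ l ∈ Finset.range (y + 1),
        laguerreCoeff a x k * laguerreCoeff a y l * t ^ (k + l) := by
    intro t
    simp only [laguerrePoly, eval_finsetSum, eval_mul, eval_C, eval_pow, eval_X,
      Finset.sum_mul_sum]
    refine Finset.sum_congr rfl fun k _ => Finset.sum_congr rfl fun l _ => ?_
    rw [pow_add]
    ring
  simp only [h1]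
  rw [integral_finsetSum _ fun k _ => integrable_finsetSum _ fun l _ => (hρ (k + l)).const_mul _]
  refine Finset.sum_congr rfl fun k _ => ?_
  rw [integral_finsetSum _ fun l _ => (hρ (k + l)).const_mul _]
  refine Finset.sum_congr rfl fun l _ => ?_
  rw [integral_const_mul]

/-- Orthogonality of the Laguerre polynomials, as the limit of the orthogonality relations for the
dual Hahn polynomials. -/
theorem polyInner_laguerrePoly (ha : -1 < a) (x y : ℕ) :
    polyInner (laguerreMeasure (a + 1)) (laguerrePoly a x) (laguerrePoly a y) =
      if x = y then Real.Gamma (a + 1) / ((ascPochhammer ℝ x).eval (a + 1) / x.factorial)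
        else 0 := by
  have hb : (-1 : ℝ) < 0 := by norm_num
  have hM : Tendsto (fun N : ℕ => ((id N : ℕ) : ℝ)) atTop atTop := tendsto_natCast_atTop_atTop
  have h1 := tendsto_dualHahnSum_hahnPoly (b := 0) ha hM
    (fun i => tendsto_dualHahnSum_pow ha hb hM i) x y
  have h2 : Tendsto (fun N => if x = y then hahnWeight a 0 (id N) 0 / hahnWeight a 0 (id N) x
      else 0) atTop (𝓝 (if x = y then 1 / ((ascPochhammer ℝ x).eval (a + 1) / x.factorial)
        else 0)) := by
    split_ifs
    · have h3 := (tendsto_hahnWeight_div ha hb hM x).inv₀ (div_pos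
        (ascPochhammer_eval_add_one_pos ha x) (by positivity)).ne'
      simpa [inv_div] using h3
    · exact tendsto_const_nhds
  have h3 : ∑ k ∈ Finset.range (x + 1), ∑ l ∈ Finset.range (y + 1),
        laguerreCoeff a x k * laguerreCoeff a y l * (ascPochhammer ℝ (k + l)).eval (a + 1) =
      if x = y then 1 / ((ascPochhammer ℝ x).eval (a + 1) / x.factorial) else 0 := by
    refine tendsto_nhds_unique h1 (h2.congr' ?_)
    filter_upwards [eventually_ge_atTop x, eventually_ge_atTop y] with N hx hy
    exact (sum_dualHahnWeight_mul ha hb hx hy).symm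
  rw [polyInner, integral_laguerrePoly_mul (integrable_pow_laguerreMeasure ha)]
  simp only [integral_pow_laguerreMeasure ha, ← mul_left_comm (Real.Gamma (a + 1)),
    ← Finset.mul_sum]
  rw [h3]
  split_ifs <;> simp [div_eq_mul_inv]

theorem laguerreCoeff_self (a : ℝ) (x : ℕ) :
    laguerreCoeff a x x = (-1) ^ x / (ascPochhammer ℝ x).eval (a + 1) := by
  simp [laguerreCoeff]

theorem laguerrePoly_natDegree (ha : -1 < a) (x : ℕ) :
    (laguerrePoly a x).natDegree = x ∧
      (laguerrePoly a x).leadingCoeff = (-1) ^ x / (ascPochhammer ℝ x).eval (a + 1) := by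
  have hcoef : (laguerrePoly a x).coeff x = (-1) ^ x / (ascPochhammer ℝ x).eval (a + 1) := by
    rw [laguerrePoly, finsetSum_coeff, Finset.sum_eq_single_of_mem x (by simp)]
    · rw [coeff_C_mul, coeff_X_pow_self, mul_one, laguerreCoeff_self]
    · intro k _ hk
      rw [coeff_C_mul, coeff_X_pow, if_neg hk.symm, mul_zero]
  have hne : (-1 : ℝ) ^ x / (ascPochhammer ℝ x).eval (a + 1) ≠ 0 :=
    div_ne_zero (by simp) (ascPochhammer_eval_add_one_pos ha x).ne'
  have hdeg : (laguerrePoly a x).natDegree = x := by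
    refine le_antisymm ?_ (le_natDegree_of_ne_zero (by rw [hcoef]; exact hne))
    refine natDegree_sum_le_of_forall_le _ _ fun k hk => ?_
    have := Finset.mem_range.1 hk
    exact (natDegree_C_mul_X_pow_le _ _).trans (by omega)
  exact ⟨hdeg, by rw [leadingCoeff, hdeg, hcoef]⟩

theorem orthonormalPoly_laguerreMeasure (ha : -1 < a) (x : ℕ) :
    orthonormalPoly (laguerreMeasure (a + 1)) x =
      C ((-1) ^ x * (√((ascPochhammer ℝ x).eval (a + 1) / x.factorial) /
        √(Real.Gamma (a + 1)))) * laguerrePoly a x := by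
  have hG := Real.Gamma_pos_of_pos (show 0 < a + 1 by linarith)
  have hasc := ascPochhammer_eval_add_one_pos ha
  rw [orthonormalPoly_eq (integrable_eval_laguerreMeasure ha) (m := x)
    (fun n _ => by
      rw [(laguerrePoly_natDegree ha n).2]
      exact div_ne_zero (by simp) (hasc n).ne')
    (fun n _ => (laguerrePoly_natDegree ha n).1)
    (fun i _ j _ hij => by rw [polyInner_laguerrePoly ha, if_neg hij])
    (fun i _ => by
      rw [polyInner_laguerrePoly ha, if_pos rfl]
      exact div_pos hG (div_pos (hasc i) (by positivity))) x le_rfl]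
  rw [polyInner_laguerrePoly ha, if_pos rfl, (laguerrePoly_natDegree ha x).2, abs_div,
    abs_pow, abs_neg, abs_one, one_pow, abs_of_pos (hasc x), Real.sqrt_div hG.le]
  congr 2
  have h1 := (hasc x).ne'
  have h2 : (-1 : ℝ) ^ x * (-1) ^ x = 1 := by rw [← mul_pow]; simp
  have h3 : (-1 : ℝ) ^ x ≠ 0 := by simp
  have h4 : √((ascPochhammer ℝ x).eval (a + 1) / x.factorial) ≠ 0 :=
    (Real.sqrt_pos.2 (div_pos (hasc x) (by positivity))).ne'
  have h5 : √(Real.Gamma (a + 1)) ≠ 0 := (Real.sqrt_pos.2 hG).ne'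
  have h6 : 1 / (ascPochhammer ℝ x).eval (a + 1) / ((-1) ^ x / (ascPochhammer ℝ x).eval (a + 1))
      = (-1) ^ x := by
    field_simp
    linarith
  rw [h6]
  field_simp

theorem discreteKernelMinus_laguerreMeasure (ha : -1 < a) (r : ℝ) (x y : ℕ) :
    discreteKernelMinus (laguerreMeasure (a + 1)) r x y = (-1) ^ x * (-1) ^ y *
      (√((ascPochhammer ℝ x).eval (a + 1) / x.factorial) *
        √((ascPochhammer ℝ y).eval (a + 1) / y.factorial) *
      ∑ k ∈ Finset.range (x + 1), ∑ l ∈ Finset.range (y + 1),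
        laguerreCoeff a x k * laguerreCoeff a y l *
          ∫ t in Set.Iio r, t ^ (k + l) ∂(laguerreProbability ha : Measure ℝ)) := by
  have hG := Real.Gamma_pos_of_pos (show 0 < a + 1 by linarith)
  rw [discreteKernelMinus, orthonormalPoly_laguerreMeasure ha, orthonormalPoly_laguerreMeasure ha,
    ← integral_laguerrePoly_mul fun k => (integrable_pow_laguerreProbability ha k).integrableOn,
    setIntegral_laguerreProbability]
  set A := √((ascPochhammer ℝ x).eval (a + 1) / x.factorial)
  set B := √((ascPochhammer ℝ y).eval (a + 1) / y.factorial)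
  have h1 : (Real.Gamma (a + 1))⁻¹ = (√(Real.Gamma (a + 1)))⁻¹ * (√(Real.Gamma (a + 1)))⁻¹ := by
    rw [← mul_inv, Real.mul_self_sqrt hG.le]
  rw [h1, ← integral_const_mul, ← integral_const_mul, ← integral_const_mul]
  congr 1
  ext t
  simp only [eval_mul, eval_C]
  ring

end Laguerre

/-! ### The limit transition -/

section Limit

variable {a b : ℝ}

noncomputable section

/-- The probability measure given by the dual Hahn weights on the scaled dual lattice. -/
def dualHahnMeasure (a b : ℝ) (M : ℕ) : Measure ℝ :=
  ∑ n ∈ Finset.range (M + 1),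
    ENNReal.ofReal (dualHahnWeight a b M n) • Measure.dirac (hahnEigenvalue a b n / M)

end

theorem integrable_dualHahnMeasure (M : ℕ) (f : ℝ → ℝ) : Integrable f (dualHahnMeasure a b M) := by
  rw [dualHahnMeasure, integrable_finsetSum_measure]
  exact fun x _ => (integrable_dirac (by simp)).smul_measure ENNReal.ofReal_ne_top

theorem integral_dualHahnMeasure (ha : -1 < a) (hb : -1 < b) (M : ℕ) (f : ℝ → ℝ) :
    ∫ t, f t ∂(dualHahnMeasure a b M) = dualHahnSum a b M (M + 1) f := by
  have h := integrable_dualHahnMeasure (a := a) (b := b) M f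
  rw [dualHahnMeasure, integrable_finsetSum_measure] at h
  rw [dualHahnMeasure, integral_finsetSum_measure h, dualHahnSum]
  refine Finset.sum_congr rfl fun n _ => ?_
  rw [integral_smul_measure, integral_dirac,
    ENNReal.toReal_ofReal (dualHahnWeight_pos ha hb n).le, smul_eq_mul]

theorem isProbabilityMeasure_dualHahnMeasure (ha : -1 < a) (hb : -1 < b) (M : ℕ) :
    IsProbabilityMeasure (dualHahnMeasure a b M) := by
  have h := integral_dualHahnMeasure ha hb M (dualHahnFactor a b M 0)
  rw [dualHahnSum_dualHahnFactor ha hb (Nat.zero_le M)] at h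
  constructor
  have h0 : dualHahnFactor a b M 0 = fun _ => 1 := by ext t; simp [dualHahnFactor]
  rw [h0] at h
  simpa [Measure.real, ENNReal.toReal_eq_one_iff] using h

theorem hahnEigenvalue_nonneg (ha : -1 < a) (hb : -1 < b) (n : ℕ) : 0 ≤ hahnEigenvalue a b n := by
  have h := (hahnEigenvalue_strictMono ha hb).monotone (Nat.zero_le n)
  simpa [hahnEigenvalue] using h

theorem ae_nonneg_dualHahnMeasure (ha : -1 < a) (hb : -1 < b) (M : ℕ) :
    ∀ᵐ t ∂(dualHahnMeasure a b M), 0 ≤ t := by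
  have hm : MeasurableSet {t : ℝ | ¬ 0 ≤ t} := (measurableSet_Ici (a := (0 : ℝ))).compl
  rw [ae_iff, dualHahnMeasure]
  simp only [Measure.coe_finsetSum, Finset.sum_apply, Measure.smul_apply, smul_eq_mul]
  refine Finset.sum_eq_zero fun n _ => ?_
  rw [Measure.dirac_apply' _ hm, Set.indicator_of_notMem, mul_zero]
  exact not_not.2 (div_nonneg (hahnEigenvalue_nonneg ha hb n) M.cast_nonneg)

theorem integral_Iio_dualHahnMeasure (ha : -1 < a) (hb : -1 < b) {M N : ℕ} (hM : 0 < M)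
    (hN : N ≤ M) (k : ℕ) :
    ∫ t in Set.Iio (hahnEigenvalue a b N / M), max t 0 ^ k ∂(dualHahnMeasure a b M) =
      dualHahnSum a b M N (fun t => t ^ k) := by
  have hM' : (0 : ℝ) < M := by exact_mod_cast hM
  rw [← integral_indicator measurableSet_Iio, integral_dualHahnMeasure ha hb, dualHahnSum,
    dualHahnSum, ← Finset.sum_subset (Finset.range_mono (show N ≤ M + 1 by omega))]
  · refine Finset.sum_congr rfl fun n hn => ?_
    have h1 := hahnEigenvalue_strictMono ha hb (Finset.mem_range.1 hn)
    rw [Set.indicator_of_mem (show _ ∈ Set.Iio _ from div_lt_div_of_pos_right h1 hM'),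
      max_eq_left (div_nonneg (hahnEigenvalue_nonneg ha hb n) hM'.le)]
  · intro n _ hn
    have h1 := (hahnEigenvalue_strictMono ha hb).monotone (not_lt.1 (mt Finset.mem_range.2 hn))
    rw [Set.indicator_of_notMem (show _ ∉ Set.Iio _ from
      not_lt.2 (div_le_div_of_nonneg_right h1 hM'.le)), mul_zero]

variable {M : ℕ → ℕ}

theorem tendsto_dualHahnSum_truncated (ha : -1 < a) (hb : -1 < b) {r : ℝ}
    (hM : Tendsto (fun N => (M N : ℝ)) atTop atTop) (hN : ∀ᶠ N in atTop, N ≤ M N)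
    (hτ : Tendsto (fun N => hahnEigenvalue a b N / M N) atTop (𝓝 r)) (k : ℕ) :
    Tendsto (fun N => dualHahnSum a b (M N) N (fun t => t ^ k)) atTop
      (𝓝 (∫ t in Set.Iio r, t ^ k ∂(laguerreProbability ha : Measure ℝ))) := by
  let ν : ℕ → ProbabilityMeasure ℝ := fun N =>
    ⟨dualHahnMeasure a b (M N), isProbabilityMeasure_dualHahnMeasure ha hb (M N)⟩
  have hν : ∀ N, (ν N : Measure ℝ) = dualHahnMeasure a b (M N) := fun N => rfl
  have hpos := ae_pos_laguerreProbability ha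
  have hconv : Tendsto ν atTop (𝓝 (laguerreProbability ha)) := by
    refine tendsto_of_tendsto_moments (fun N k => integrable_dualHahnMeasure _ _)
      (integrable_pow_laguerreProbability ha) (fun N => ae_nonneg_dualHahnMeasure ha hb _)
      (hpos.mono fun t ht => ht.le) ?_ ?_
    · intro k
      simp only [hν, integral_dualHahnMeasure ha hb, integral_pow_laguerreProbability ha]
      exact tendsto_dualHahnSum_pow ha hb hM k
    · intro k
      simp only [integral_pow_laguerreProbability ha]
      exact tendsto_half_pow_div_factorial_mul_ascPochhammer ha k
  have hae : ∀ᵐ t ∂(laguerreProbability ha : Measure ℝ), t ^ k = max t 0 ^ k :=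
    hpos.mono fun t ht => by rw [max_eq_left ht.le]
  have h := tendsto_integral_Iio hconv (f := fun t => max t 0 ^ k) (by fun_prop)
    (fun t => by positivity) (fun s => ⟨max s 0 ^ k, fun t ht => by gcongr⟩)
    ((integrable_pow_laguerreProbability ha k).congr hae) hτ
  rw [setIntegral_congr_ae measurableSet_Iio (hae.mono fun t ht _ => ht)]
  refine h.congr' ?_
  filter_upwards [hN, eventually_lt_of_tendsto hM 0] with N h1 h2
  exact integral_Iio_dualHahnMeasure ha hb h2 h1 k

theorem tendsto_det_hahnKernel (ha : -1 < a) (hb : -1 < b) {r : ℝ}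
    (hM : Tendsto (fun N => (M N : ℝ)) atTop atTop) (hN : ∀ᶠ N in atTop, N ≤ M N)
    (hτ : Tendsto (fun N => hahnEigenvalue a b N / M N) atTop (𝓝 r)) (Y : Finset ℕ) :
    Tendsto (fun N => (Matrix.of fun x y : Y => hahnKernel N a b (M N) x y).det) atTop
      (𝓝 (Matrix.of fun x y : Y =>
        discreteKernelMinus (laguerreMeasure (a + 1)) r x y).det) := by
  have h1 : ∀ x y : ℕ, Tendsto (fun N => hahnKernel N a b (M N) x y) atTop (𝓝
      (√((ascPochhammer ℝ x).eval (a + 1) / x.factorial) *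
        √((ascPochhammer ℝ y).eval (a + 1) / y.factorial) *
      ∑ k ∈ Finset.range (x + 1), ∑ l ∈ Finset.range (y + 1),
        laguerreCoeff a x k * laguerreCoeff a y l *
          ∫ t in Set.Iio r, t ^ (k + l) ∂(laguerreProbability ha : Measure ℝ))) := by
    intro x y
    have h := (((tendsto_hahnWeight_div ha hb hM x).sqrt).mul
      ((tendsto_hahnWeight_div ha hb hM y).sqrt)).mul
      (tendsto_dualHahnSum_hahnPoly (A := id) ha hM
        (tendsto_dualHahnSum_truncated ha hb hM hN hτ) x y)
    exact h.congr' (hN.mono fun N hN => (hahnKernel_eq ha hb hN x y).symm)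
  simp only [discreteKernelMinus_laguerreMeasure ha]
  rw [Matrix.det_of_gauge (fun x : Y => (-1 : ℝ) ^ (x : ℕ))
    (fun x => by rw [← mul_pow]; simp)]
  refine ((continuous_id.matrix_det).tendsto _).comp ?_
  exact tendsto_pi_nhds.2 fun x => tendsto_pi_nhds.2 fun y => h1 x y

theorem tendsto_hahnEigenvalue_div {r : ℝ} (hr : 0 < r)
    (hM : (fun N : ℕ => (M N : ℝ)) ~[atTop] fun N : ℕ => (N : ℝ) ^ 2 / r) :
    Tendsto (fun N => hahnEigenvalue a b N / M N) atTop (𝓝 r) := by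
  have h1 : (fun N : ℕ => hahnEigenvalue a b N) ~[atTop] fun N : ℕ => (N : ℝ) ^ 2 := by
    refine (isEquivalent_iff_tendsto_one ?_).2 ?_
    · filter_upwards [eventually_gt_atTop 0] with N hN
      positivity
    · have h2 : Tendsto (fun N : ℕ => 1 + (a + b + 1) / (N : ℝ)) atTop (𝓝 (1 + 0)) :=
        tendsto_const_nhds.add (tendsto_natCast_atTop_atTop.const_div_atTop _)
      rw [add_zero] at h2
      refine h2.congr' ?_
      filter_upwards [eventually_gt_atTop 0] with N hN
      have : (N : ℝ) ≠ 0 := by positivity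
      simp only [Pi.div_apply, hahnEigenvalue]
      field_simp
      ring
  refine (h1.div hM).symm.tendsto_nhds (tendsto_const_nhds.congr' ?_)
  filter_upwards [eventually_gt_atTop 0] with N hN
  have : (N : ℝ) ≠ 0 := by positivity
  simp only [Pi.div_apply]
  field_simp

theorem tendsto_atTop_of_isEquivalent_sq {r : ℝ} (hr : 0 < r)
    (hM : (fun N : ℕ => (M N : ℝ)) ~[atTop] fun N : ℕ => (N : ℝ) ^ 2 / r) :
    Tendsto (fun N => (M N : ℝ)) atTop atTop ∧ ∀ᶠ N in atTop, N ≤ M N := by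
  have hN := tendsto_natCast_atTop_atTop (R := ℝ)
  refine ⟨hM.symm.tendsto_atTop
    (((tendsto_pow_atTop two_ne_zero).comp hN).atTop_div_const hr), ?_⟩
  have h1 := (isEquivalent_iff_tendsto_one (by
    filter_upwards [eventually_gt_atTop 0] with N hN
    positivity)).1 hM
  filter_upwards [h1.eventually_const_lt (show (1 / 2 : ℝ) < 1 by norm_num),
    hN.eventually_ge_atTop (2 * r), eventually_gt_atTop 0] with N h2 h3 h4
  have h5 : (0 : ℝ) < N := by exact_mod_cast h4
  rw [Pi.div_apply, lt_div_iff₀ (by positivity)] at h2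
  have h6 : (N : ℝ) ≤ 1 / 2 * ((N : ℝ) ^ 2 / r) := by
    rw [mul_div_assoc', le_div_iff₀ hr]
    nlinarith
  exact_mod_cast h6.trans h2.le

end Limit

theorem mainTheorem11 (r a b : ℝ) (hr : 0 < r) (ha : -1 < a) (hb : -1 < b) (M : ℕ → ℕ)
    (hM : (fun N : ℕ => (M N : ℝ)) ~[atTop] fun N : ℕ => (N : ℝ) ^ 2 / r) :
    (∀ N : ℕ, N ≤ M N →
      IsDeterminantal (hahnKernel N a b (M N)) (hahnEnsemble N a b (M N))) ∧
    IsDeterminantal (discreteKernelMinus (laguerreMeasure (a + 1)) r)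
      (discreteLaguerreMinus r (a + 1)) ∧
    Tendsto (fun N : ℕ => hahnEnsemble N a b (M N)) atTop
      (𝓝 (discreteLaguerreMinus r (a + 1))) := by
  obtain ⟨hM', hN⟩ := tendsto_atTop_of_isEquivalent_sq hr hM
  obtain ⟨Q, hQ, hlim⟩ := exists_isDeterminantal_tendsto
    (hN.mono fun N h => isDeterminantal_hahnEnsemble ha hb h)
    (tendsto_det_hahnKernel ha hb hM' hN (tendsto_hahnEigenvalue_div hr hM))
  have hD : IsDeterminantal (discreteKernelMinus (laguerreMeasure (a + 1)) r)
      (discreteLaguerreMinus r (a + 1)) := IsDeterminantal.determinantalMeasure ⟨Q, hQ⟩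
  refine ⟨fun N h => isDeterminantal_hahnEnsemble ha hb h, hD, ?_⟩
  rwa [hD.unique hQ]
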